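/- Setting. The centres $X_1, X_2, \dots$ of objects form a homogeneous Poisson point process in $\mathbb{R}^2$ with intensity $\lambda \in (0,\infty)$. The objects carry i.i.d. marks $M_i = (A_i, Y_i, S_i^0)$, independent of the centres (the components of one mark may be dependent), where $A_i$ is a random closed convex set, the shape of object $i$. Write $E_i = \{X_i\} \oplus A_i$, $E = \bigcup_i E_i$ and $E^{-i} = \bigcup_{j \ne i} E_j$; the complement of $E$ is the void space. Each object is a sensor with probability $p_s \in (0,1]$ (this too is determined by its mark). If $i$ is a sensor, then $Y_i \in A_i$ is the relative placement of the sensor and $S_i^0 = \{(r,\vartheta) : \vartheta \in [0,2\pi],\ 0 \le r \le r^i_{\max}(\vartheta)\}$ (polar coordinates) is its radial sensing support, with a finite range $r^i_{\max}(\vartheta) \ge 0$ that depends measurably on the mark and on $\vartheta$. If $i$ is not a sensor, then $Y_i = 0$ and $S_i^0 = \emptyset$. The coverage set of sensor $i$ is $$C_i = \{x \in \{X_i + Y_i\} \oplus S_i^0 : x \in E_i \text{ or } l_{X_i+Y_i,x} \cap E^{-i} \subseteq \{x\}\},$$ where $l_{y,z}$ is the closed line segment from $y$ to $z$. The sensing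 redundancy $R(x)$ of a location $x$, when all sensors collaborate, is the number of sensors $i$ with $x \in C_i$. Let $A$ be distributed as the shape of an object. Let $C^0, A^0, Y^0, S^0$ denote the coverage set (shifted by minus the centre), shape, sensor placement and radial support of a typical sensor, that is, under the Palm distribution of the process of sensors, which has intensity $p_s \lambda$. Thus $(A^0,Y^0,S^0)$ has the law of a mark conditioned on its object being a sensor. Let $|\cdot|$ be area, $\check A = \{-a : a \in A\}$, and assume $\mathbb{E}|A| < \infty$. Theorem. For every $x \in \mathbb{R}^2$ one has $\mathbb{P}(x \notin E) > 0$ and, as an identity in $[0,\infty]$, $$\mathbb{E}[R(x) \mid x \notin E] = \frac{p_s\, \lambda\, \mathbb{E}|C^0 \setminus A^0|}{e^{-\lambda \mathbb{E}|A|}},$$ where $$\mathbb{E}|C^0 \setminus A^0| = \mathbb{E}\left[\int_{(\{Y^0\} \oplus S^0) \setminus A^0} e^{-\lambda\, g(Y^0,u)}\, du\right], \qquad g(y,u) = \mathbb{E}|l_{y,u} \oplus \check A|,$$ with $e^{-\infty} = 0$. Here $A$ is independent of $(A^0,Y^0,S^0)$, so $g$ is computed with $A$ alone. -/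

import Mathlib

open MeasureTheory ProbabilityTheory
open scoped ENNReal NNReal Pointwise

noncomputable section

namespace CollabSensing

/-- The plane, with the Euclidean norm and Lebesgue measure `volume`. -/
abbrev Plane : Type := EuclideanSpace ℝ (Fin 2)

/-- The number of indices `i` with `X i ω` in `B`. -/
def pointCount {Ω : Type*} (X : ℕ → Ω → Plane) (B : Set Plane) (ω : Ω) : ℕ∞ :=
  {i : ℕ | X i ω ∈ B}.encard

/-- `X 0, X 1, …` enumerates the points of a homogeneous Poisson point process of intensity `lam`
in the plane: counts in bounded Borel sets are Poisson with mean `lam * area`, and counts in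
pairwise disjoint sets are independent. (For `lam > 0` such a process has infinitely many points
almost surely, so that it is enumerated by `ℕ`.) -/
structure IsHPPP {Ω : Type*} [MeasurableSpace Ω] (P : Measure Ω) (lam : ℝ≥0)
    (X : ℕ → Ω → Plane) : Prop where
  measurable : ∀ i, Measurable (X i)
  poisson : ∀ B : Set Plane, MeasurableSet B → Bornology.IsBounded B → ∀ k : ℕ,
    P {ω | pointCount X B ω = k} = poissonMeasure (lam * (volume B).toNNReal) {k}
  indep : ∀ (n : ℕ) (B : Fin n → Set Plane),
    (∀ a, MeasurableSet (B a)) → (∀ a, Bornology.IsBounded (B a)) →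
    Pairwise (Function.onFun Disjoint B) →
    iIndepFun (fun a => pointCount X (B a)) P

/-- The set with polar description `{(r, θ) | r ∈ [0, rmax θ], θ ∈ [0, 2π]}`. -/
def polarRegion (rmax : ℝ → ℝ≥0) : Set Plane :=
  {z | ∃ θ ∈ Set.Icc (0 : ℝ) (2 * Real.pi), ∃ r ∈ Set.Icc (0 : ℝ) (rmax θ),
    z = !₂[r * Real.cos θ, r * Real.sin θ]}

/-- How a mark `m` (an element of an arbitrary measurable space) describes an object:
its shape `A`, whether it carries a sensor, the placement `Y` of the sensor relative to the
centre of the object, and the maximum sensing range in each direction. -/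
structure ObjectModel (𝕄 : Type*) [MeasurableSpace 𝕄] where
  /-- the shape `A`, referenced to the origin -/
  shape : 𝕄 → Set Plane
  shape_closed : ∀ m, IsClosed (shape m)
  shape_convex : ∀ m, Convex ℝ (shape m)
  /-- `shape` is a random closed set: measurable for the Fell sigma-algebra -/
  shape_measurable : ∀ K : Set Plane, IsCompact K → MeasurableSet {m | (shape m ∩ K).Nonempty}
  /-- the marks of those objects that are sensors -/
  sensors : Set 𝕄
  sensors_measurable : MeasurableSet sensors
  /-- the relative placement `Y` of the sensor -/
  offset : 𝕄 → Plane
  offset_measurable : Measurable offset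
  offset_mem : ∀ m ∈ sensors, offset m ∈ shape m
  offset_eq_zero : ∀ m ∉ sensors, offset m = 0
  /-- the maximum sensing range in direction `θ ∈ [0, 2π]` -/
  range : 𝕄 → ℝ → ℝ≥0
  range_measurable : Measurable (Function.uncurry range)

namespace ObjectModel

variable {𝕄 : Type*} [MeasurableSpace 𝕄] (O : ObjectModel 𝕄)

/-- The radial sensing support `S⁰`, referenced to the location of the sensor; it is empty for
an object that is not a sensor. -/
def support (m : 𝕄) : Set Plane :=
  {z | m ∈ O.sensors ∧ z ∈ polarRegion (O.range m)}

/-- The expected area of the shape of an object, when marks have law `F`. -/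
def meanArea (F : Measure 𝕄) : ℝ≥0∞ := ∫⁻ m, volume (O.shape m) ∂F

/-- The expected area of `L ⊕ Ǎ`, where `Ǎ = -A` is the reflected shape of an object. -/
def meanDilatedArea (F : Measure 𝕄) (L : Set Plane) : ℝ≥0∞ :=
  ∫⁻ m, volume (L + -O.shape m) ∂F

/-- The expectation, over the mark `(A⁰, Y⁰, S⁰)` of a typical sensor (the law of a mark
conditioned on the object being a sensor), of the integral over `({Y⁰} ⊕ S⁰) \ A⁰` of
`exp (-lam * E|l_{Y⁰, u} ⊕ Ǎ|)`. The exponential is `0` if the mean area is infinite. -/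
def visibleAreaIntegral (F : Measure 𝕄) (lam : ℝ≥0) : ℝ≥0∞ :=
  ∫⁻ m, ∫⁻ u in ({O.offset m} + O.support m) \ O.shape m,
    EReal.exp (-((lam * O.meanDilatedArea F (segment ℝ (O.offset m) u) : ℝ≥0∞) : EReal))
      ∂volume ∂(F[|O.sensors])

end ObjectModel

/-- The environment and sensing field: an independently marked homogeneous Poisson process with
intensity `lam` and mark law `F`. -/
structure IsSensingField {Ω 𝕄 : Type*} [MeasurableSpace Ω] [MeasurableSpace 𝕄]
    (P : Measure Ω) (lam : ℝ≥0) (F : Measure 𝕄)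
    (X : ℕ → Ω → Plane) (M : ℕ → Ω → 𝕄) : Prop where
  isHPPP : IsHPPP P lam X
  mark_measurable : ∀ i, Measurable (M i)
  mark_law : ∀ i, P.map (M i) = F
  mark_indep : iIndepFun M P
  mark_indep_points : IndepFun (fun ω i => X i ω) (fun ω i => M i ω) P

section Realization

/-! Notions for one realization: `X i` is the location and `M i` the mark of object `i`. -/

variable {𝕄 : Type*} [MeasurableSpace 𝕄] (O : ObjectModel 𝕄) (X : ℕ → Plane) (M : ℕ → 𝕄)

/-- The region `E_i` occupied by object `i`. -/
def occupied (i : ℕ) : Set Plane := {X i} + O.shape (M i)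

/-- The region `E` occupied by all objects; its complement is the void space. -/
def environment : Set Plane := ⋃ i, occupied O X M i

/-- The region `E^{-i}` occupied by the objects other than `i`. -/
def environmentExcept (i : ℕ) : Set Plane := ⋃ j ∈ {j : ℕ | j ≠ i}, occupied O X M j

/-- The coverage set `C_i` of object `i` (empty unless `i` is a sensor). -/
def coverage (i : ℕ) : Set Plane :=
  {x | x ∈ {X i + O.offset (M i)} + O.support (M i) ∧
    (x ∈ occupied O X M i ∨
      segment ℝ (X i + O.offset (M i)) x ∩ environmentExcept O X M i ⊆ {x})}

/-- The locations of the sensors. -/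
def sensorLocations : Set Plane := {z | ∃ i, M i ∈ O.sensors ∧ X i = z}

/-- The sensing redundancy of location `x` when the sensors located in `K` collaborate: the
number of them that view `x`. -/
def redundancy (K : Set Plane) (x : Plane) : ℝ≥0∞ :=
  ∑' i : ℕ, {i : ℕ | X i ∈ K ∧ x ∈ coverage O X M i}.indicator 1 i

/-- The area of `C⁰ \ A⁰` as seen from object `i`: the coverage set of `i` is shifted by `-X i`,
and the shape of `i` is removed. -/
def coveredAreaOutside (i : ℕ) : ℝ≥0∞ :=
  volume (((-X i) +ᵥ coverage O X M i) \ O.shape (M i))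

end Realization

/-- The expectation of `f` for a typical sensor, i.e. under the Palm distribution of the
stationary process of sensors: the mean, over the sensors located in the unit square, of the
value `f i` seen from sensor `i`, divided by the intensity `lamS` of the sensors. -/
def typicalSensorExpectation {Ω 𝕄 : Type*} [MeasurableSpace Ω] [MeasurableSpace 𝕄]
    (P : Measure Ω) (O : ObjectModel 𝕄) (lamS : ℝ≥0)
    (X : ℕ → Ω → Plane) (M : ℕ → Ω → 𝕄) (f : ℕ → Ω → ℝ≥0∞) : ℝ≥0∞ :=
  (∫⁻ ω, ∑' i : ℕ,
    {i : ℕ | M i ω ∈ O.sensors ∧ ∀ k, X i ω k ∈ Set.Ico (0 : ℝ) 1}.indicator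
      (fun i => f i ω) i ∂P) / lamS

end CollabSensing

end

open MeasureTheory ProbabilityTheory
open scoped ENNReal NNReal Pointwise

namespace CollabSensing

open Filter Topology

/-! ### The exponential function on extended nonnegative numbers -/

/-! The void probability, the redundancy and the Palm expectation all reduce to void events of the
marked Poisson process. A location `x` is void when no pair (centre, mark) falls in a fixed set,
which has probability `exp (-λ E|A|)`. On that event object `i` covers `x` exactly when `x - X i`
lies in its support outside its shape and no other object meets the closed segment from the sensor
to `x`; the end point `x` of this segment already accounts for voidness with respect to the other
objects. The Mecke formula replaces the sum over `i` by `λ` times an integral over centre and mark,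
and the remaining objects miss the segment `l` with probability `exp (-λ E|l ⊕ Ǎ|)`, because a
translate `z + A` hits `l` iff `z ∈ l ⊕ Ǎ`. Hence `E[R(x); x ∉ E] = λ I`, where `I` is
`meanVisibleArea`.

The area `|C⁰ \ A⁰|` is the integral over `u` of a similar indicator, now with the end point of the
segment removed, since coverage allows the target itself to be occupied. The removal costs no area:
both dilations are convex with the same closure, and the frontier of a convex set is null. So `p_s λ
E|C⁰ \ A⁰| = λ I` too, and `I / p_s` is the integral formula.

The Mecke formula itself is derived from the counts. Independence over disjoint sets gives the
Laplace functional (`IsHPPP.lintegral_expNeg`) and the independence of the process inside and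
outside a set `Q`; this settles the case of a point of `Q` interacting only with points off `Q`.
Summation over dyadic squares and refinement of the squares yield interaction with all other
locations, and simplicity (`ae_injective`) turns other locations into other indices. Marks are
averaged first (`IsSensingField.mecke`): for given locations, the event for object `i` has as
probability a product over `j ≠ i`, hence the exponential of a sum over points. Values in `[0, ∞]`
accommodate factors that are zero. -/

/-- The exponential `exp (-a)` of an extended nonnegative number. -/
noncomputable def expNeg (a : ℝ≥0∞) : ℝ≥0∞ := EReal.exp (-(a : EReal))

/-- The extended nonnegative number `-log p`, for `p ≤ 1`. -/
noncomputable def negLog (p : ℝ≥0∞) : ℝ≥0∞ := (-(ENNReal.log p)).toENNReal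

@[simp] lemma expNeg_zero : expNeg 0 = 1 := by simp [expNeg]

lemma expNeg_coe (a : ℝ≥0) : expNeg a = ENNReal.ofReal (Real.exp (-a)) := by
  have : (-((a : ℝ≥0∞) : EReal)) = ((-(a : ℝ) : ℝ) : EReal) := by
    rw [EReal.coe_neg]; rfl
  rw [expNeg, this, EReal.exp_coe]

lemma expNeg_add (a b : ℝ≥0∞) : expNeg (a + b) = expNeg a * expNeg b := by
  rw [expNeg, EReal.coe_ennreal_add, EReal.neg_add (Or.inl (EReal.coe_ennreal_ne_bot a))
    (Or.inr (EReal.coe_ennreal_ne_bot b)), sub_eq_add_neg, EReal.exp_add]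
  rfl

lemma expNeg_antitone : Antitone expNeg := fun _ _ h =>
  EReal.exp_monotone (EReal.neg_le_neg_iff.2 (EReal.coe_ennreal_le_coe_ennreal_iff.2 h))

lemma expNeg_le_one (a : ℝ≥0∞) : expNeg a ≤ 1 := by
  simpa using expNeg_antitone (zero_le (a := a))

lemma expNeg_ne_top (a : ℝ≥0∞) : expNeg a ≠ ∞ :=
  ((expNeg_le_one a).trans_lt ENNReal.one_lt_top).ne

lemma expNeg_pos {a : ℝ≥0∞} (h : a ≠ ∞) : 0 < expNeg a := by
  lift a to ℝ≥0 using h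
  rw [expNeg_coe]
  exact ENNReal.ofReal_pos.2 (Real.exp_pos _)

lemma continuous_expNeg : Continuous expNeg :=
  ENNReal.continuous_exp.comp (continuous_neg.comp continuous_coe_ennreal_ereal)

@[fun_prop] lemma measurable_expNeg : Measurable expNeg := continuous_expNeg.measurable

lemma expNeg_sum {ι : Type*} (s : Finset ι) (f : ι → ℝ≥0∞) :
    expNeg (∑ i ∈ s, f i) = ∏ i ∈ s, expNeg (f i) := by
  classical
  induction s using Finset.induction_on with
  | empty => simp
  | insert a s ha ih => rw [Finset.sum_insert ha, Finset.prod_insert ha, expNeg_add, ih]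

lemma expNeg_mul_natCast (c : ℝ≥0∞) (k : ℕ) : expNeg (c * k) = expNeg c ^ k := by
  induction k with
  | zero => simp
  | succ k ih => rw [Nat.cast_succ, mul_add, mul_one, expNeg_add, ih, pow_succ]

lemma expNeg_tsum {ι : Type*} (f : ι → ℝ≥0∞) :
    expNeg (∑' i, f i) = ∏' i, expNeg (f i) := by
  have h1 : Tendsto (fun s : Finset ι => expNeg (∑ i ∈ s, f i)) atTop
      (𝓝 (expNeg (∑' i, f i))) :=
    (continuous_expNeg.tendsto _).comp ENNReal.summable.hasSum
  have h2 : Tendsto (fun s : Finset ι => ∏ i ∈ s, expNeg (f i)) atTop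
      (𝓝 (∏' i, expNeg (f i))) :=
    (ENNReal.multipliable_of_le_one (fun i => expNeg_le_one (f i))).hasProd
  simp_rw [expNeg_sum] at h1
  exact tendsto_nhds_unique h1 h2

lemma expNeg_negLog {p : ℝ≥0∞} (hp : p ≤ 1) : expNeg (negLog p) = p := by
  have h : (0 : EReal) ≤ -ENNReal.log p := by
    rw [EReal.neg_nonneg]
    simpa using ENNReal.log_monotone hp
  rw [expNeg, negLog, EReal.coe_toENNReal h, neg_neg, ENNReal.exp_log]

@[fun_prop] lemma measurable_negLog : Measurable negLog :=
  (EReal.continuous_toENNReal.comp (continuous_neg.comp ENNReal.continuous_log)).measurable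

/-- The probability generating function of a Poisson distribution. -/
lemma tsum_poissonMeasure_mul_pow (r : ℝ≥0) (c : ℝ≥0∞) :
    ∑' k : ℕ, expNeg c ^ k * poissonMeasure r {k} = expNeg (r * (1 - expNeg c)) := by
  obtain ⟨s, hs⟩ : ∃ s : ℝ≥0, expNeg c = s := ⟨_, (ENNReal.coe_toNNReal (expNeg_ne_top c)).symm⟩
  have hs1 : s ≤ 1 := by
    have := expNeg_le_one c
    rw [hs] at this
    exact_mod_cast this
  have h1 : ∀ k : ℕ, expNeg c ^ k * poissonMeasure r {k}
      = ENNReal.ofReal (Real.exp (-r) * ((r * s : ℝ) ^ k / (k.factorial : ℝ))) := by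
    intro k
    rw [hs, poissonMeasure_singleton, ← ENNReal.ofReal_coe_nnreal, ← ENNReal.ofReal_pow s.coe_nonneg,
      ← ENNReal.ofReal_mul (by positivity)]
    congr 1
    rw [mul_pow]; ring
  have hsum : HasSum (fun k : ℕ => Real.exp (-r) * ((r * s : ℝ) ^ k / (k.factorial : ℝ)))
      (Real.exp (-r) * Real.exp (r * s)) := by
    apply HasSum.mul_left
    have := NormedSpace.expSeries_div_hasSum_exp (r * s : ℝ)
    rwa [← Real.exp_eq_exp_ℝ] at this
  simp_rw [h1]
  rw [← ENNReal.ofReal_tsum_of_nonneg (fun k => by positivity) hsum.summable, hsum.tsum_eq, hs,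
    ← Real.exp_add]
  have : (r : ℝ≥0∞) * (1 - (s : ℝ≥0∞)) = ((r * (1 - s) : ℝ≥0) : ℝ≥0∞) := by
    push_cast; rfl
  rw [this, expNeg_coe, NNReal.coe_mul, NNReal.coe_sub hs1]
  congr 2
  simp; ring

/-- The mean of a Poisson distribution. -/
lemma tsum_natCast_mul_poissonMeasure (r : ℝ≥0) :
    ∑' k : ℕ, (k : ℝ≥0∞) * poissonMeasure r {k} = r := by
  have h1 : ∀ k : ℕ, ((k + 1 : ℕ) : ℝ≥0∞) * poissonMeasure r {k + 1}
      = r * poissonMeasure r {k} := by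
    intro k
    rw [poissonMeasure_singleton, poissonMeasure_singleton, ← ENNReal.ofReal_natCast,
      ← ENNReal.ofReal_coe_nnreal, ← ENNReal.ofReal_mul (by positivity),
      ← ENNReal.ofReal_mul (by positivity)]
    congr 1
    rw [Nat.factorial_succ]
    push_cast
    field_simp
    ring
  rw [tsum_eq_zero_add' ENNReal.summable]
  simp_rw [h1]
  rw [ENNReal.tsum_mul_left]
  have : ∑' k : ℕ, poissonMeasure r {k} = 1 := by
    rw [← measure_iUnion (fun i j hij => by simpa using hij) (fun _ => measurableSet_singleton _)]
    simp [Set.iUnion_of_singleton]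
  simp [this]

/-- From `exp (-r) ≥ 1 - r` one gets `1 - (1 + r) exp (-r) ≤ 1 - (1 + r)(1 - r)`. The quadratic
order is what makes double points disappear when cells shrink. -/
lemma poissonMeasure_two_le (r : ℝ≥0) :
    1 - poissonMeasure r {0} - poissonMeasure r {1} ≤ (r : ℝ≥0∞) ^ 2 := by
  rw [poissonMeasure_singleton, poissonMeasure_singleton, ← ENNReal.ofReal_one,
    ← ENNReal.ofReal_sub _ (by positivity), ← ENNReal.ofReal_sub _ (by positivity),
    ← ENNReal.ofReal_coe_nnreal, ← ENNReal.ofReal_pow r.coe_nonneg]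
  apply ENNReal.ofReal_le_ofReal
  have h := Real.add_one_le_exp (-(r : ℝ))
  have h0 : 0 ≤ (r : ℝ) := r.2
  simp
  nlinarith

end CollabSensing

namespace CollabSensing

open Filter Topology

/-! ### Laplace functional of a Poisson process -/

/-- The counting measure of a sequence of points in the plane. -/
noncomputable def pointMeasure (ξ : ℕ → Plane) : Measure Plane :=
  Measure.sum fun i => Measure.dirac (ξ i)

lemma lintegral_pointMeasure (ξ : ℕ → Plane) (f : Plane → ℝ≥0∞) :
    ∫⁻ z, f z ∂pointMeasure ξ = ∑' i, f (ξ i) := by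
  simp [pointMeasure, lintegral_sum_measure]

lemma pointMeasure_apply (ξ : ℕ → Plane) {B : Set Plane} (hB : MeasurableSet B) :
    pointMeasure ξ B = ∑' i, B.indicator 1 (ξ i) := by
  simp [pointMeasure, Measure.sum_apply _ hB, Measure.dirac_apply' _ hB]

lemma pointMeasure_eq_pointCount {Ω : Type*} (X : ℕ → Ω → Plane) (ω : Ω) {B : Set Plane}
    (hB : MeasurableSet B) :
    pointMeasure (X · ω) B = (pointCount X B ω : ℝ≥0∞) := by
  rw [pointMeasure_apply _ hB, pointCount, ← ENNReal.tsum_set_one,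
    tsum_subtype {i | X i ω ∈ B} (fun _ => (1 : ℝ≥0∞))]
  rfl

variable {Ω : Type*} [MeasurableSpace Ω] {P : Measure Ω} {lam : ℝ≥0} {X : ℕ → Ω → Plane}

lemma measurable_pointMeasure_apply (hX : ∀ i, Measurable (X i)) {B : Set Plane}
    (hB : MeasurableSet B) : Measurable fun ω => pointMeasure (X · ω) B := by
  simp_rw [pointMeasure_apply _ hB]
  exact Measurable.tsum fun i => (measurable_one.indicator hB).comp (hX i)

lemma measurable_pointCount (hX : ∀ i, Measurable (X i)) {B : Set Plane}
    (hB : MeasurableSet B) : Measurable (pointCount X B) := by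
  rw [ENat.measurable_iff]
  intro n
  have : pointCount X B ⁻¹' {(n : ℕ∞)} = (fun ω => pointMeasure (X · ω) B) ⁻¹' {(n : ℝ≥0∞)} := by
    ext ω
    simp only [Set.mem_preimage, Set.mem_singleton_iff, pointMeasure_eq_pointCount X ω hB]
    rw [← ENat.toENNReal_coe, ENat.toENNReal_inj]
  rw [this]
  exact measurable_pointMeasure_apply hX hB (measurableSet_singleton _)

namespace IsHPPP

lemma iIndepFun_pointCount (hX : IsHPPP P lam X) {ι : Type*} [Fintype ι] {B : ι → Set Plane}
    (hB : ∀ a, MeasurableSet (B a)) (hb : ∀ a, Bornology.IsBounded (B a))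
    (hd : Pairwise (Function.onFun Disjoint B)) :
    iIndepFun (fun a => pointCount X (B a)) P := by
  have e := (Fintype.equivFin ι)
  have h := hX.indep _ (fun a => B (e.symm a)) (fun a => hB _) (fun a => hb _)
    (fun a b hab => hd (e.symm.injective.ne hab))
  have := h.precomp (g := e) e.injective
  simpa using this

variable [IsProbabilityMeasure P]

/-- The definition prescribes only the probabilities of finite counts. These add up to one, so the
value `⊤` has probability zero and the law is determined. -/
lemma map_pointCount (hX : IsHPPP P lam X) {B : Set Plane} (hB : MeasurableSet B)
    (hb : Bornology.IsBounded B) :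
    P.map (pointCount X B) =
      (poissonMeasure (lam * (volume B).toNNReal)).map ((↑) : ℕ → ℕ∞) := by
  have hm := measurable_pointCount hX.measurable hB
  have h1 : ∀ k : ℕ, P.map (pointCount X B) {(k : ℕ∞)}
      = poissonMeasure (lam * (volume B).toNNReal) {k} := by
    intro k
    rw [Measure.map_apply hm (measurableSet_singleton _)]
    exact hX.poisson B hB hb k
  have : IsProbabilityMeasure (P.map (pointCount X B)) :=
    Measure.isProbabilityMeasure_map hm.aemeasurable
  refine Measure.ext_of_singleton fun a => ?_
  rw [Measure.map_apply (f := ((↑) : ℕ → ℕ∞)) (measurable_of_countable _)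
    (measurableSet_singleton _)]
  induction a using ENat.recTopCoe with
  | coe k =>
    rw [h1]
    congr 1
    ext; simp
  | top =>
    have h2 : P.map (pointCount X B) (Set.range ((↑) : ℕ → ℕ∞)) = 1 := by
      rw [← Set.iUnion_singleton_eq_range, measure_iUnion _ (fun _ => measurableSet_singleton _)]
      · simp_rw [h1]
        rw [← measure_iUnion (fun i j hij => by simpa using hij)
          (fun _ => measurableSet_singleton _)]
        simp [Set.iUnion_of_singleton]
      · intro i j hij
        simpa [Function.onFun] using hij
    have h3 : P.map (pointCount X B) {⊤} = 0 := by
      refine measure_mono_null ?_ ((prob_compl_eq_zero_iff (MeasurableSet.of_discrete)).2 h2)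
      rintro _ rfl ⟨k, hk⟩
      exact ENat.natCast_ne_top k hk
    rw [h3]
    have : ((↑) : ℕ → ℕ∞) ⁻¹' {⊤} = ∅ := by
      ext; simp
    simp [this]

lemma lintegral_pointCount (hX : IsHPPP P lam X) {B : Set Plane} (hB : MeasurableSet B)
    (hb : Bornology.IsBounded B) (f : ℕ∞ → ℝ≥0∞) :
    ∫⁻ ω, f (pointCount X B ω) ∂P =
      ∑' k : ℕ, f k * poissonMeasure (lam * (volume B).toNNReal) {k} := by
  rw [← lintegral_map (measurable_of_countable f) (measurable_pointCount hX.measurable hB),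
    hX.map_pointCount hB hb, lintegral_map (measurable_of_countable f) (measurable_of_countable _),
    lintegral_countable']

lemma coe_intensity {B : Set Plane} (hb : Bornology.IsBounded B) :
    ((lam * (volume B).toNNReal : ℝ≥0) : ℝ≥0∞) = lam * volume B := by
  rw [ENNReal.coe_mul, ENNReal.coe_toNNReal hb.measure_lt_top.ne]

lemma lintegral_pointMeasure_apply (hX : IsHPPP P lam X) {B : Set Plane} (hB : MeasurableSet B)
    (hb : Bornology.IsBounded B) :
    ∫⁻ ω, pointMeasure (X · ω) B ∂P = lam * volume B := by
  simp_rw [pointMeasure_eq_pointCount X _ hB]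
  rw [hX.lintegral_pointCount hB hb (fun n => (n : ℝ≥0∞)), ← coe_intensity hb]
  simpa only [ENat.toENNReal_coe] using tsum_natCast_mul_poissonMeasure _

lemma measure_two_le (hX : IsHPPP P lam X) {B : Set Plane} (hB : MeasurableSet B)
    (hb : Bornology.IsBounded B) :
    P {ω | 2 ≤ pointCount X B ω} ≤ (lam * volume B) ^ 2 := by
  have hm := measurable_pointCount hX.measurable hB
  have hsub : {ω | 2 ≤ pointCount X B ω} ⊆
      (({ω | pointCount X B ω = (0 : ℕ)} ∪ {ω | pointCount X B ω = (1 : ℕ)}))ᶜ := by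
    intro ω hω h
    rcases h with h | h <;> simp only [Set.mem_ofPred_eq] at h hω <;> rw [h] at hω <;>
      revert hω <;> norm_num
  refine (measure_mono hsub).trans ?_
  have hm0 : ∀ k : ℕ, MeasurableSet {ω | pointCount X B ω = k} := fun k =>
    hm (measurableSet_singleton _)
  rw [measure_compl ((hm0 0).union (hm0 1)) (measure_ne_top _ _), measure_univ,
    measure_union _ (hm0 1), hX.poisson B hB hb, hX.poisson B hB hb, ← tsub_tsub,
    ← coe_intensity hb]
  · exact poissonMeasure_two_le _
  · rw [Set.disjoint_left]
    intro ω h h'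
    simp only [Set.mem_ofPred_eq] at h h'
    rw [h] at h'
    norm_num at h'

/-- The exponential factorises over independent counts, and each factor is a Poisson generating
function. -/
lemma lintegral_expNeg_sum (hX : IsHPPP P lam X) {ι : Type*} [Fintype ι] {B : ι → Set Plane}
    (hB : ∀ a, MeasurableSet (B a)) (hb : ∀ a, Bornology.IsBounded (B a))
    (hd : Pairwise (Function.onFun Disjoint B)) (c : ι → ℝ≥0∞) :
    ∫⁻ ω, expNeg (∑ a, c a * pointMeasure (X · ω) (B a)) ∂P =
      expNeg (lam * ∑ a, (1 - expNeg (c a)) * volume (B a)) := by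
  simp_rw [expNeg_sum, Finset.mul_sum, expNeg_sum, pointMeasure_eq_pointCount X _ (hB _)]
  have hi := (hX.iIndepFun_pointCount hB hb hd).comp (fun a n => expNeg (c a * n))
    (fun a => measurable_of_countable _)
  have h := lintegral_prod_eq_prod_lintegral_of_indepFun Finset.univ _ hi
    (fun a => (measurable_of_countable _).comp (measurable_pointCount hX.measurable (hB a)))
  refine h.trans (Finset.prod_congr rfl fun a _ => ?_)
  refine (hX.lintegral_pointCount (hB a) (hb a) (fun n => expNeg (c a * n))).trans ?_
  simp only [ENat.toENNReal_coe, expNeg_mul_natCast]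
  rw [tsum_poissonMeasure_mul_pow, coe_intensity (hb a), mul_assoc, mul_comm (volume (B a))]

lemma lintegral_expNeg_simpleFunc (hX : IsHPPP P lam X) (f : SimpleFunc Plane ℝ≥0∞)
    {W : Set Plane} (hW : MeasurableSet W) (hb : Bornology.IsBounded W) :
    ∫⁻ ω, expNeg (∫⁻ z in W, f z ∂pointMeasure (X · ω)) ∂P =
      expNeg (lam * ∫⁻ z in W, (1 - expNeg (f z))) := by
  have h1 : ∀ (μ : Measure Plane) (g : ℝ≥0∞ → ℝ≥0∞),
      ∫⁻ z in W, g (f z) ∂μ = ∑ c : f.range, g c * μ (f ⁻¹' {(c : ℝ≥0∞)} ∩ W) := by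
    intro μ g
    have : ∀ z, g (f z) = f.map g z := fun z => rfl
    simp_rw [this]
    rw [SimpleFunc.lintegral_eq_lintegral, SimpleFunc.map_lintegral,
      ← Finset.sum_coe_sort f.range]
    refine Finset.sum_congr rfl fun c _ => ?_
    rw [Measure.restrict_apply (f.measurableSet_fiber _)]
  rw [h1 volume (fun c => 1 - expNeg c)]
  simp_rw [fun ω => h1 (pointMeasure (X · ω)) (fun c => c)]
  refine hX.lintegral_expNeg_sum (fun c => (f.measurableSet_fiber _).inter hW)
    (fun c => hb.subset Set.inter_subset_right) ?_ (fun c : f.range => (c : ℝ≥0∞))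
  intro c d hcd
  refine Disjoint.mono Set.inter_subset_left Set.inter_subset_left ?_
  exact Disjoint.preimage _ (Set.disjoint_singleton.2 fun h => hcd (Subtype.ext h))

end IsHPPP

/-- An increasing sequence of bounded windows exhausting the plane. -/
def window (k : ℕ) : Set Plane := Metric.ball 0 k

lemma measurableSet_window (k : ℕ) : MeasurableSet (window k) := measurableSet_ball

lemma isBounded_window (k : ℕ) : Bornology.IsBounded (window k) := Metric.isBounded_ball

lemma monotone_window : Monotone window := fun _ _ h =>
  Metric.ball_subset_ball (by exact_mod_cast h)

lemma iUnion_window : ⋃ k, window k = Set.univ := Metric.iUnion_ball_nat 0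

lemma eventually_mem_window (z : Plane) : ∀ᶠ k in atTop, z ∈ window k := by
  obtain ⟨k, hk⟩ := Set.mem_iUnion.1 (iUnion_window.ge (Set.mem_univ z))
  exact eventually_atTop.2 ⟨k, fun l hl => monotone_window hl hk⟩

/-- The Laplace functional of a homogeneous Poisson process. -/
theorem IsHPPP.lintegral_expNeg [IsProbabilityMeasure P] (hX : IsHPPP P lam X) {q : Plane → ℝ≥0∞} (hq : Measurable q) :
    ∫⁻ ω, expNeg (∫⁻ z, q z ∂pointMeasure (X · ω)) ∂P =
      expNeg (lam * ∫⁻ z, (1 - expNeg (q z))) := by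
  -- The cut-off to a window keeps the fibres of the simple function bounded, where the counts are
  -- known to be Poisson; the sequence still increases to `q`.
  let g : ℕ → Plane → ℝ≥0∞ := fun k => (window k).indicator (SimpleFunc.eapprox q k)
  have hgm : ∀ k, Measurable (g k) := fun k =>
    (SimpleFunc.measurable _).indicator (measurableSet_window k)
  have hmono : ∀ z, Monotone fun k => g k z := by
    intro z k l hkl
    refine (Set.indicator_le_indicator (SimpleFunc.monotone_eapprox q hkl z)).trans ?_
    exact Set.indicator_le_indicator_of_subset (monotone_window hkl) (fun _ => zero_le) z
  have htend : ∀ z, Tendsto (fun k => g k z) atTop (𝓝 (q z)) := by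
    intro z
    refine (SimpleFunc.tendsto_eapprox hq z).congr' ?_
    filter_upwards [eventually_mem_window z] with k hk
    exact (Set.indicator_of_mem hk _).symm
  have h1 : ∀ k, ∫⁻ ω, expNeg (∫⁻ z, g k z ∂pointMeasure (X · ω)) ∂P =
      expNeg (lam * ∫⁻ z, (1 - expNeg (g k z))) := by
    intro k
    have e : ∀ z, 1 - expNeg (g k z)
        = (window k).indicator (fun z => 1 - expNeg (SimpleFunc.eapprox q k z)) z := by
      intro z
      by_cases hz : z ∈ window k <;> simp [g, hz]
    simp_rw [e]
    simp only [g, lintegral_indicator (measurableSet_window k)]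
    exact hX.lintegral_expNeg_simpleFunc _ (measurableSet_window k) (isBounded_window k)
  have hconv : ∀ μ : Measure Plane, Tendsto (fun k => ∫⁻ z, g k z ∂μ) atTop (𝓝 (∫⁻ z, q z ∂μ)) :=
    fun μ => lintegral_tendsto_of_tendsto_of_monotone (fun k => (hgm k).aemeasurable)
      (ae_of_all _ hmono) (ae_of_all _ htend)
  have h2 : Tendsto (fun k => ∫⁻ ω, expNeg (∫⁻ z, g k z ∂pointMeasure (X · ω)) ∂P) atTop
      (𝓝 (∫⁻ ω, expNeg (∫⁻ z, q z ∂pointMeasure (X · ω)) ∂P)) := by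
    refine tendsto_lintegral_of_dominated_convergence (fun _ => 1) (fun k => ?_)
      (fun k => ae_of_all _ fun ω => expNeg_le_one _) (by simp)
      (ae_of_all _ fun ω => (continuous_expNeg.tendsto _).comp (hconv _))
    simp_rw [lintegral_pointMeasure]
    have := hX.measurable
    fun_prop
  have h3 : Tendsto (fun k => expNeg (lam * ∫⁻ z, (1 - expNeg (g k z)))) atTop
      (𝓝 (expNeg (lam * ∫⁻ z, (1 - expNeg (q z))))) := by
    refine (continuous_expNeg.tendsto _).comp
      (ENNReal.Tendsto.const_mul ?_ (Or.inr ENNReal.coe_ne_top))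
    refine lintegral_tendsto_of_tendsto_of_monotone
      (fun k => (measurable_const.sub (measurable_expNeg.comp (hgm k))).aemeasurable)
      (ae_of_all _ fun z k l hkl => tsub_le_tsub_left (expNeg_antitone (hmono z hkl)) _)
      (ae_of_all _ fun z => ?_)
    exact ENNReal.Tendsto.sub tendsto_const_nhds ((continuous_expNeg.tendsto _).comp (htend z))
      (Or.inl ENNReal.one_ne_top)
  simp_rw [h1] at h2
  exact tendsto_nhds_unique h2 h3

end CollabSensing

namespace CollabSensing

open Filter Topology

/-! ### Independence of a Poisson process in complementary regions -/

/-- The kernel that maps a measure to itself, if the measure is finite on all windows. It is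
s-finite, in contrast to the identity on all measures. -/
noncomputable def locallyFiniteKernel : Kernel (Measure Plane) Plane :=
  Kernel.sum fun p : ℕ × ℕ =>
    Kernel.piecewise
      (s := {v : Measure Plane | v (disjointed window p.1) ∈ Set.Ico (p.2 : ℝ≥0∞) (p.2 + 1)})
      ((Measure.measurable_coe (MeasurableSet.disjointed measurableSet_window p.1))
        measurableSet_Ico)
      (Kernel.restrict ⟨id, measurable_id⟩ (MeasurableSet.disjointed measurableSet_window p.1)) 0

/-- Each summand keeps the measure on one annulus, and only if its mass there lies in `[l, l + 1)`;
it is therefore bounded by `l + 1`. -/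
instance : IsSFiniteKernel locallyFiniteKernel := by
  classical
  refine @Kernel.isSFiniteKernel_sum _ _ _ _ _ _ _ fun p => ?_
  suffices h : IsFiniteKernel (Kernel.piecewise
      (s := {v : Measure Plane | v (disjointed window p.1) ∈ Set.Ico (p.2 : ℝ≥0∞) (p.2 + 1)})
      ((Measure.measurable_coe (MeasurableSet.disjointed measurableSet_window p.1))
        measurableSet_Ico)
      (Kernel.restrict (⟨id, measurable_id⟩ : Kernel (Measure Plane) Plane)
        (MeasurableSet.disjointed measurableSet_window p.1)) 0) from inferInstance
  refine ⟨⟨p.2 + 1, by finiteness, fun v => ?_⟩⟩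
  rw [Kernel.piecewise_apply]
  split_ifs with h
  · rw [Kernel.restrict_apply, Measure.restrict_apply_univ]
    exact h.2.le
  · simp

lemma locallyFiniteKernel_apply {v : Measure Plane} (hv : ∀ k, v (window k) < ∞) :
    locallyFiniteKernel v = v := by
  classical
  have hW := MeasurableSet.disjointed measurableSet_window
  have hfin : ∀ k, v (disjointed window k) < ∞ := fun k =>
    (measure_mono (disjointed_subset _ _)).trans_lt (hv k)
  ext B hB
  rw [locallyFiniteKernel, Kernel.sum_apply' _ _ hB, ENNReal.tsum_prod']
  have h1 : ∀ k, ∑' l : ℕ, (Kernel.piecewise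
      (s := {v : Measure Plane | v (disjointed window k) ∈ Set.Ico (l : ℝ≥0∞) (l + 1)})
      ((Measure.measurable_coe (hW k)) measurableSet_Ico)
      (Kernel.restrict (⟨id, measurable_id⟩ : Kernel (Measure Plane) Plane) (hW k)) 0) v B
      = v.restrict (disjointed window k) B := by
    intro k
    lift v (disjointed window k) to ℝ≥0 using (hfin k).ne with r hr
    -- Exactly one of the intervals `[l, l + 1)` contains the finite mass `r`.
    rw [tsum_eq_single ⌊r⌋₊]
    · rw [Kernel.piecewise_apply', if_pos, Kernel.restrict_apply]
      · rfl
      · change v (disjointed window k) ∈ Set.Ico _ _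
        rw [← hr]
        exact ⟨by exact_mod_cast Nat.floor_le (zero_le (a := r)),
          by exact_mod_cast Nat.lt_floor_add_one r⟩
    · intro l hl
      rw [Kernel.piecewise_apply', if_neg]
      · simp
      · intro h
        change v (disjointed window k) ∈ Set.Ico _ _ at h
        rw [← hr] at h
        refine hl ((Nat.floor_eq_iff zero_le).2 ⟨by exact_mod_cast h.1, by exact_mod_cast h.2⟩).symm
  refine (tsum_congr h1).trans ?_
  rw [← Measure.sum_apply _ hB, ← Measure.restrict_iUnion (disjoint_disjointed _) hW,
    iUnion_disjointed, iUnion_window, Measure.restrict_univ]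

/-- Joint measurability of an integral in parameter and measure holds for s-finite kernels, which is
the reason for working with `locallyFiniteKernel` instead of the identity. -/
lemma measurable_lintegral_locallyFiniteKernel {q : Plane → Plane → ℝ≥0∞}
    (hq : Measurable (Function.uncurry q)) :
    Measurable fun p : Plane × Measure Plane => ∫⁻ z, q p.1 z ∂locallyFiniteKernel p.2 := by
  have : Measurable (Function.uncurry fun (p : Plane × Measure Plane) (z : Plane) => q p.1 z) :=
    hq.comp ((measurable_fst.comp measurable_fst).prodMk measurable_snd)
  exact Measurable.lintegral_kernel_prod_right (κ := Kernel.prodMkLeft Plane locallyFiniteKernel)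
    this

/-- The sigma-algebra on `Ω` is left free so that it can be the one generated by counts outside `Q`.
The mass of `D` is a supremum of counts in bounded sets disjoint from `Q`. -/
lemma measurable_restrict_pointMeasure {Ω : Type*} {m : MeasurableSpace Ω} {X : ℕ → Ω → Plane}
    {Q : Set Plane} (hQ : MeasurableSet Q)
    (h : ∀ B, MeasurableSet B → Bornology.IsBounded B → Disjoint Q B →
      Measurable (pointCount X B)) :
    Measurable fun ω => (pointMeasure (X · ω)).restrict Qᶜ := by
  refine Measure.measurable_of_measurable_coe _ fun D hD => ?_
  have hDk : ∀ k, MeasurableSet (D ∩ Qᶜ ∩ window k) := fun k =>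
    (hD.inter hQ.compl).inter (measurableSet_window k)
  have h1 : ∀ ω, (pointMeasure (X · ω)).restrict Qᶜ D
      = ⨆ k, (pointCount X (D ∩ Qᶜ ∩ window k) ω : ℝ≥0∞) := by
    intro ω
    simp_rw [← pointMeasure_eq_pointCount X ω (hDk _)]
    rw [Measure.restrict_apply hD, ← Monotone.measure_iUnion, ← Set.inter_iUnion, iUnion_window,
      Set.inter_univ]
    exact fun i j hij => Set.inter_subset_inter_right _ (monotone_window hij)
  simp_rw [h1]
  refine Measurable.iSup fun k => (measurable_of_countable _).comp (h _ (hDk k)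
    ((isBounded_window k).subset Set.inter_subset_right) ?_)
  exact disjoint_compl_right.mono_right (Set.inter_subset_left.trans Set.inter_subset_right)

variable {Ω : Type*} [MeasurableSpace Ω] {P : Measure Ω}
  {lam : ℝ≥0} {X : ℕ → Ω → Plane}

namespace IsHPPP

/-- The sets `B a` may overlap, whereas independence is given for disjoint sets only. The atoms
generated by the `B a`, together with `A`, are disjoint, and each count in `B a` is a sum of counts
in atoms. -/
lemma indepFun_pointCount_family (hX : IsHPPP P lam X) {ι : Type*} [Fintype ι]
    {A : Set Plane} {B : ι → Set Plane} (hA : MeasurableSet A) (hAb : Bornology.IsBounded A)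
    (hB : ∀ a, MeasurableSet (B a)) (hb : ∀ a, Bornology.IsBounded (B a))
    (hd : ∀ a, Disjoint A (B a)) :
    IndepFun (fun ω a => pointCount X (B a) ω) (pointCount X A) P := by
  classical
  -- The atom of `s` consists of the points lying in `B a` for exactly the `a ∈ s`. Intersection
  -- with the union keeps every atom bounded and disjoint from `A`, including that of the empty set.
  let at' : Finset ι → Set Plane := fun s =>
    (⋃ a, B a) ∩ {z | Finset.univ.filter (fun a => z ∈ B a) = s}
  have hfib : ∀ s : Finset ι, MeasurableSet {z | Finset.univ.filter (fun a => z ∈ B a) = s} := by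
    intro s
    have : {z | Finset.univ.filter (fun a => z ∈ B a) = s} = ⋂ a, {z | z ∈ B a ↔ a ∈ s} := by
      ext z
      simp [Finset.ext_iff]
    rw [this]
    refine MeasurableSet.iInter fun a => ?_
    by_cases h : a ∈ s
    · simpa [h] using hB a
    · have : {z | z ∈ B a ↔ a ∈ s} = (B a)ᶜ := by
        ext z
        simp [h]
      rw [this]
      exact (hB a).compl
  have hat : ∀ s, MeasurableSet (at' s) := fun s => (MeasurableSet.iUnion hB).inter (hfib s)
  let D : Option (Finset ι) → Set Plane := fun o => o.elim A at'
  have hDm : ∀ o, MeasurableSet (D o) := by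
    rintro (_ | s)
    exacts [hA, hat s]
  have hDb : ∀ o, Bornology.IsBounded (D o) := by
    rintro (_ | s)
    exacts [hAb, (Bornology.isBounded_iUnion.2 hb).subset Set.inter_subset_left]
  have hAat : ∀ s, Disjoint A (at' s) := fun s =>
    (Set.disjoint_iUnion_right.2 hd).mono_right Set.inter_subset_left
  have hDd : Pairwise (Function.onFun Disjoint D) := by
    rintro (_ | s) (_ | t) hst
    · exact absurd rfl hst
    · exact hAat t
    · exact (hAat s).symm
    · refine Set.disjoint_left.2 fun z hz hz' => hst ?_
      have h1 := hz.2
      have h2 := hz'.2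
      simp only [Set.mem_ofPred_eq] at h1 h2
      rw [← h1, ← h2]
  have hind := hX.iIndepFun_pointCount hDm hDb hDd
  have h := hind.indepFun_finset (Finset.univ.erase none) {none} (by simp)
    (fun o => measurable_pointCount hX.measurable (hDm o))
  have hsum : ∀ a ω, pointCount X (B a) ω
      = ∑ s : ↥(Finset.univ.erase (none : Option (Finset ι))),
        if ∃ t : Finset ι, a ∈ t ∧ (s : Option (Finset ι)) = some t
          then pointCount X (D s) ω else 0 := by
    intro a ω
    rw [← ENat.toENNReal_inj]
    rw [Finset.sum_coe_sort (Finset.univ.erase (none : Option (Finset ι)))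
      (fun s => if ∃ t : Finset ι, a ∈ t ∧ s = some t then pointCount X (D s) ω else 0),
      ← Finset.sum_filter]
    have h2 : B a = ⋃ s ∈ (Finset.univ.erase (none : Option (Finset ι))).filter
        (fun s => ∃ t : Finset ι, a ∈ t ∧ s = some t), D s := by
      ext z
      simp only [Set.mem_iUnion, Finset.mem_filter, Finset.mem_erase, exists_prop]
      constructor
      · intro hz
        refine ⟨some (Finset.univ.filter (fun a => z ∈ B a)),
          ⟨⟨by simp, by simp⟩, _, by simpa using hz, rfl⟩, Set.mem_iUnion.2 ⟨a, hz⟩, rfl⟩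
      · rintro ⟨_, ⟨_, t, hat, rfl⟩, hz⟩
        have := hz.2
        simp only [Set.mem_ofPred_eq] at this
        rw [← this] at hat
        simpa using hat
    rw [← pointMeasure_eq_pointCount X ω (hB a), h2,
      measure_biUnion_finset (fun s _ t _ hst => hDd hst) (fun s _ => hDm s)]
    simp_rw [pointMeasure_eq_pointCount X ω (hDm _)]
    exact (map_sum ENat.toENNRealRingHom _ _).symm
  have h3 := h.comp (φ := fun (v : ↥(Finset.univ.erase (none : Option (Finset ι))) → ℕ∞) (a : ι) =>
      ∑ s : ↥(Finset.univ.erase (none : Option (Finset ι))),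
        if ∃ t : Finset ι, a ∈ t ∧ (s : Option (Finset ι)) = some t then v s else 0)
    (ψ := fun v : ↥({none} : Finset (Option (Finset ι))) → ℕ∞ => v ⟨none, by simp⟩)
    (measurable_of_countable _) (measurable_of_countable _)
  have h4 : (fun ω a => pointCount X (B a) ω) =
      (fun (v : ↥(Finset.univ.erase (none : Option (Finset ι))) → ℕ∞) (a : ι) =>
      ∑ s : ↥(Finset.univ.erase (none : Option (Finset ι))),
        if ∃ t : Finset ι, a ∈ t ∧ (s : Option (Finset ι)) = some t then v s else 0) ∘
        fun ω s => pointCount X (D s) ω := by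
    funext ω a
    exact hsum a ω
  rw [h4]
  exact h3

variable [IsProbabilityMeasure P]

/-- Finite families of counts off `Q` generate a directed family of sigma-algebras, each independent
of the count in `A`. So is their supremum, for which the restricted point measure is measurable. -/
lemma indepFun_restrict_pointMeasure (hX : IsHPPP P lam X) {A Q : Set Plane}
    (hA : MeasurableSet A) (hAb : Bornology.IsBounded A) (hQ : MeasurableSet Q) (hAQ : A ⊆ Q) :
    IndepFun (fun ω => (pointMeasure (X · ω)).restrict Qᶜ) (pointCount X A) P := by
  let 𝓑 := {B : Set Plane // MeasurableSet B ∧ Bornology.IsBounded B ∧ Disjoint Q B}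
  let m : Finset 𝓑 → MeasurableSpace Ω := fun s =>
    MeasurableSpace.comap (fun ω (B : s) => pointCount X (B : 𝓑).1 ω) inferInstance
  have hmeas : ∀ s : Finset 𝓑, Measurable (fun ω (B : s) => pointCount X (B : 𝓑).1 ω) := fun s =>
    measurable_pi_lambda _ fun B => measurable_pointCount hX.measurable (B : 𝓑).2.1
  have hI : Indep (⨆ s, m s) (MeasurableSpace.comap (pointCount X A) inferInstance) P := by
    refine indep_iSup_of_directed_le (fun s => ?_) (fun s => (hmeas s).comap_le)
      (measurable_pointCount hX.measurable hA).comap_le ?_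
    · exact hX.indepFun_pointCount_family hA hAb (fun B : s => (B : 𝓑).2.1)
        (fun B => (B : 𝓑).2.2.1) (fun B => (B : 𝓑).2.2.2.mono_left hAQ)
    · have hmono : Monotone m := by
        intro s t hst
        have : (fun ω (B : s) => pointCount X (B : 𝓑).1 ω)
            = (fun (v : t → ℕ∞) (B : s) => v ⟨B, hst B.2⟩) ∘
              (fun ω (B : t) => pointCount X (B : 𝓑).1 ω) := rfl
        simp only [m]
        rw [this, ← MeasurableSpace.comap_comp]
        refine MeasurableSpace.comap_mono ?_
        exact (measurable_pi_lambda (fun (v : t → ℕ∞) (B : s) => v ⟨B, hst B.2⟩)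
          fun B => measurable_pi_apply _).comap_le
      classical
      exact hmono.directed_le
  refine indep_of_indep_of_le_left hI ?_
  rw [← measurable_iff_comap_le]
  refine measurable_restrict_pointMeasure hQ fun D hDm hDb hD => ?_
  let B : 𝓑 := ⟨D, hDm, hDb, hD⟩
  have hle : m {B} ≤ ⨆ s, m s := le_iSup m {B}
  refine Measurable.mono ?_ hle le_rfl
  exact (measurable_of_countable (fun v : (({B} : Finset 𝓑) → ℕ∞) => v ⟨B, by simp⟩)).comp (comap_measurable _)

/-- The measure summing the laws of the pairs (point of `Q`, process off `Q`) is a product: on a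
rectangle, independence splits it into a mean count, `λ` times an area, and a probability.
Integrating `f` against both descriptions gives the formula. -/
lemma lintegral_tsum_restrict (hX : IsHPPP P lam X) {Q : Set Plane} (hQ : MeasurableSet Q)
    (hQb : Bornology.IsBounded Q) {f : Plane → Measure Plane → ℝ≥0∞}
    (hf : Measurable (Function.uncurry f)) :
    ∫⁻ ω, ∑' i, Q.indicator (fun x => f x ((pointMeasure (X · ω)).restrict Qᶜ)) (X i ω) ∂P =
      lam * ∫⁻ x in Q, ∫⁻ ω, f x ((pointMeasure (X · ω)).restrict Qᶜ) ∂P := by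
  set T : Ω → Measure Plane := fun ω => (pointMeasure (X · ω)).restrict Qᶜ with hT
  have hTm : Measurable T :=
    measurable_restrict_pointMeasure hQ fun _ hB _ _ => measurable_pointCount hX.measurable hB
  have hp : ∀ i, Measurable fun ω => (X i ω, T ω) := fun i => (hX.measurable i).prodMk hTm
  have := Measure.isProbabilityMeasure_map (μ := P) hTm.aemeasurable
  have hvol : IsFiniteMeasure (volume.restrict Q) := ⟨by simpa using hQb.measure_lt_top⟩
  have hprod : (lam • volume.restrict Q).prod (P.map T)
      = Measure.sum fun i => (P.map (fun ω => (X i ω, T ω))).restrict (Q ×ˢ Set.univ) := by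
    refine Measure.prod_eq fun s t hs ht => ?_
    have hst : MeasurableSet (s ×ˢ t) := hs.prod ht
    have hsQ : MeasurableSet (s ∩ Q) := hs.inter hQ
    rw [Measure.sum_apply _ hst]
    have h1 : ∀ i, (P.map (fun ω => (X i ω, T ω))).restrict (Q ×ˢ Set.univ) (s ×ˢ t)
        = ∫⁻ ω, (s ∩ Q).indicator 1 (X i ω) * (T ⁻¹' t).indicator 1 ω ∂P := by
      intro i
      rw [Measure.restrict_apply hst, Set.prod_inter_prod, Set.inter_univ,
        Measure.map_apply (hp i) (hsQ.prod ht), ← lintegral_indicator_one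
          ((hp i) (hsQ.prod ht))]
      refine lintegral_congr fun ω => ?_
      by_cases h1 : X i ω ∈ s ∩ Q <;> by_cases h2 : T ω ∈ t <;>
        simp [Set.indicator, h1, h2, -Set.mem_inter_iff]
    simp_rw [h1]
    rw [← lintegral_tsum fun i => ?_]
    swap
    · exact (((measurable_one.indicator hsQ).comp (hX.measurable i)).mul
        (measurable_one.indicator (hTm ht))).aemeasurable
    simp_rw [ENNReal.tsum_mul_right, ← pointMeasure_apply _ hsQ]
    have hind := hX.indepFun_restrict_pointMeasure hsQ (hQb.subset Set.inter_subset_right) hQ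
      Set.inter_subset_right
    have hind2 : IndepFun (fun ω => pointMeasure (X · ω) (s ∩ Q))
        ((T ⁻¹' t).indicator (1 : Ω → ℝ≥0∞)) P := by
      have := (hind.comp (φ := t.indicator (1 : Measure Plane → ℝ≥0∞))
        (ψ := fun n : ℕ∞ => (n : ℝ≥0∞))
        (measurable_one.indicator ht) (measurable_of_countable _)).symm
      have e : (fun ω => pointMeasure (X · ω) (s ∩ Q))
          = (fun n : ℕ∞ => (n : ℝ≥0∞)) ∘ pointCount X (s ∩ Q) := by
        funext ω
        exact pointMeasure_eq_pointCount X ω hsQ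
      rw [e]
      exact this
    rw [lintegral_mul_eq_lintegral_mul_lintegral_of_indepFun''
      (measurable_pointMeasure_apply hX.measurable hsQ).aemeasurable
      (measurable_one.indicator (hTm ht)).aemeasurable hind2,
      hX.lintegral_pointMeasure_apply hsQ (hQb.subset Set.inter_subset_right),
      lintegral_indicator_one (hTm ht), Measure.map_apply hTm ht, Measure.smul_apply,
      Measure.restrict_apply hs]
    rfl
  have hfm : ∀ x, Measurable (f x) := fun x => hf.of_uncurry_left
  have h2 : ∫⁻ p, f p.1 p.2 ∂((lam • volume.restrict Q).prod (P.map T))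
      = lam * ∫⁻ x in Q, ∫⁻ ω, f x (T ω) ∂P := by
    rw [lintegral_prod (fun p => f p.1 p.2) hf.aemeasurable, lintegral_smul_measure]
    simp_rw [lintegral_map (hfm _) hTm]
    rfl
  rw [← h2, hprod, lintegral_sum_measure]
  have hQu : MeasurableSet (Q ×ˢ (Set.univ : Set (Measure Plane))) := hQ.prod MeasurableSet.univ
  rw [lintegral_tsum]
  · refine tsum_congr fun i => ?_
    rw [← lintegral_indicator hQu]
    refine Eq.trans ?_ (lintegral_map (hf.indicator hQu) (hp i)).symm
    refine lintegral_congr fun ω => ?_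
    by_cases h : X i ω ∈ Q <;> simp [h, hT]
  · intro i
    have : (fun ω => Q.indicator (fun x => f x (T ω)) (X i ω))
        = fun ω => (Q ×ˢ (Set.univ : Set (Measure Plane))).indicator (Function.uncurry f)
          (X i ω, T ω) := by
      funext ω
      by_cases h : X i ω ∈ Q <;> simp [h]
    rw [this]
    exact ((hf.indicator hQu).comp (hp i)).aemeasurable

lemma ae_pointMeasure_window_lt_top (hX : IsHPPP P lam X) :
    ∀ᵐ ω ∂P, ∀ k, pointMeasure (X · ω) (window k) < ∞ := by
  rw [ae_all_iff]
  intro k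
  refine ae_lt_top (measurable_pointMeasure_apply hX.measurable (measurableSet_window k)) ?_
  rw [hX.lintegral_pointMeasure_apply (measurableSet_window k) (isBounded_window k)]
  exact ENNReal.mul_ne_top ENNReal.coe_ne_top (isBounded_window k).measure_lt_top.ne

/-- The Mecke formula for functionals that depend on a point of `Q` and on the points
outside `Q`. -/
lemma lintegral_tsum_expNeg_compl (hX : IsHPPP P lam X) {Q : Set Plane} (hQ : MeasurableSet Q)
    (hQb : Bornology.IsBounded Q) {g : Plane → ℝ≥0∞} (hg : Measurable g)
    {q : Plane → Plane → ℝ≥0∞} (hq : Measurable (Function.uncurry q)) :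
    ∫⁻ ω, ∑' i, Q.indicator (fun x => g x * expNeg (∑' j, Qᶜ.indicator (q x) (X j ω)))
        (X i ω) ∂P =
      lam * ∫⁻ x in Q, g x * expNeg (lam * ∫⁻ z in Qᶜ, (1 - expNeg (q x z))) := by
  let f : Plane → Measure Plane → ℝ≥0∞ := fun x v =>
    g x * expNeg (∫⁻ z, q x z ∂locallyFiniteKernel v)
  have hf : Measurable (Function.uncurry f) :=
    (hg.comp measurable_fst).mul
      (measurable_expNeg.comp (measurable_lintegral_locallyFiniteKernel hq))
  -- `locallyFiniteKernel` returns its argument only for measures finite on all windows, which holds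
  -- almost surely.
  have hae : ∀ᵐ ω ∂P, ∀ x, f x ((pointMeasure (X · ω)).restrict Qᶜ)
      = g x * expNeg (∑' j, Qᶜ.indicator (q x) (X j ω)) := by
    filter_upwards [hX.ae_pointMeasure_window_lt_top] with ω hω x
    simp only [f]
    rw [locallyFiniteKernel_apply (fun k => (Measure.restrict_apply_le _ _).trans_lt (hω k)),
      ← lintegral_indicator hQ.compl, lintegral_pointMeasure]
  have h1 := hX.lintegral_tsum_restrict hQ hQb hf
  rw [lintegral_congr_ae (g := fun ω => ∑' i, Q.indicator (fun x => g x *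
    expNeg (∑' j, Qᶜ.indicator (q x) (X j ω))) (X i ω))] at h1
  · rw [h1]
    congr 1
    refine setLIntegral_congr_fun hQ fun x _ => ?_
    have hqx : Measurable (q x) := hq.of_uncurry_left
    have hqm := hqx.indicator hQ.compl
    have hXm := hX.measurable
    have h2 : ∫⁻ ω, f x ((pointMeasure (X · ω)).restrict Qᶜ) ∂P
        = ∫⁻ ω, g x * expNeg (∑' j, Qᶜ.indicator (q x) (X j ω)) ∂P := by
      refine lintegral_congr_ae ?_
      filter_upwards [hae] with ω hω
      exact hω x
    rw [h2, lintegral_const_mul _ (by fun_prop)]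
    simp_rw [← lintegral_pointMeasure]
    rw [hX.lintegral_expNeg hqm, ← lintegral_indicator hQ.compl]
    congr 3
    refine lintegral_congr fun z => ?_
    by_cases h : z ∈ Q <;> simp [h]
  · filter_upwards [hae] with ω hω
    simp_rw [hω]

end IsHPPP

end CollabSensing

namespace CollabSensing

open Filter Topology

/-! ### Simplicity of a Poisson process -/

/-- The index of the dyadic square of side `2⁻ⁿ` that contains a point. -/
noncomputable def cell (n : ℕ) (z : Plane) : Fin 2 → ℤ := fun a => ⌊2 ^ n * z a⌋

@[fun_prop] lemma measurable_cell (n : ℕ) : Measurable (cell n) := by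
  unfold cell
  fun_prop

lemma dist_le_of_cell_eq {n : ℕ} {y z : Plane} (h : cell n y = cell n z) :
    dist y z ≤ 2 * (1 / 2) ^ n := by
  have h1 : ∀ a, |y a - z a| ≤ (1 / 2) ^ n := by
    intro a
    have h2 := (Int.abs_sub_lt_one_of_floor_eq_floor (congrFun h a)).le
    rw [← mul_sub, abs_mul, abs_of_pos (by positivity)] at h2
    rw [one_div, inv_pow, ← one_div, le_div_iff₀ (by positivity)]
    linarith
  rw [EuclideanSpace.dist_eq]
  refine Real.sqrt_le_iff.2 ⟨by positivity, ?_⟩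
  simp only [Fin.sum_univ_two, Real.dist_eq]
  have h3 := h1 0
  have h4 := h1 1
  nlinarith [abs_nonneg (y 0 - z 0), abs_nonneg (y 1 - z 1)]

/-- Dyadic squares are nested: a coarser index is obtained by integer division of the finer one by
two. -/
lemma cell_eq_of_le {m n : ℕ} (hmn : m ≤ n) {y z : Plane} (h : cell n y = cell n z) :
    cell m y = cell m z := by
  induction n, hmn using Nat.le_induction with
  | base => exact h
  | succ n _ ih =>
    refine ih (funext fun a => ?_)
    have h1 : ∀ w : Plane, cell n w a = cell (n + 1) w a / 2 := by
      intro w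
      have := Int.floor_div_natCast (2 ^ (n + 1) * w a) 2
      simp only [cell]
      rw [pow_succ] at this ⊢
      rw [show (2 : ℝ) ^ n * w a = 2 ^ n * 2 * w a / 2 by ring]
      simpa only [Nat.cast_ofNat] using this
    rw [h1, h1, h]

lemma eventually_cell_ne {y z : Plane} (h : y ≠ z) : ∀ᶠ n in atTop, cell n y ≠ cell n z := by
  have h1 : Tendsto (fun n : ℕ => (2 : ℝ) * (1 / 2) ^ n) atTop (𝓝 (2 * 0)) :=
    (tendsto_pow_atTop_nhds_zero_of_lt_one (by norm_num) (by norm_num)).const_mul _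
  rw [mul_zero] at h1
  filter_upwards [h1.eventually_lt_const (dist_pos.2 h)] with n hn hc
  exact absurd (dist_le_of_cell_eq hc) (not_le.2 hn)

lemma measurableSet_cell (n : ℕ) (k : Fin 2 → ℤ) : MeasurableSet (cell n ⁻¹' {k}) :=
  measurable_cell n (measurableSet_singleton _)

lemma cell_subset_closedBall {n : ℕ} {k : Fin 2 → ℤ} {z : Plane} (hz : z ∈ cell n ⁻¹' {k}) :
    cell n ⁻¹' {k} ⊆ Metric.closedBall z (2 * (1 / 2) ^ n) := fun y hy =>
  dist_le_of_cell_eq ((show cell n y = k from hy).trans (show cell n z = k from hz).symm)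

lemma isBounded_cell (n : ℕ) (k : Fin 2 → ℤ) : Bornology.IsBounded (cell n ⁻¹' {k}) := by
  rcases (cell n ⁻¹' {k}).eq_empty_or_nonempty with h | ⟨z, hz⟩
  · simp [h]
  · exact Metric.isBounded_closedBall.subset (cell_subset_closedBall hz)

lemma volume_cell_le (n : ℕ) (k : Fin 2 → ℤ) :
    volume (cell n ⁻¹' {k}) ≤ volume (Metric.closedBall (0 : Plane) (2 * (1 / 2) ^ n)) := by
  rcases (cell n ⁻¹' {k}).eq_empty_or_nonempty with h | ⟨z, hz⟩
  · simp [h]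
  · refine (measure_mono (cell_subset_closedBall hz)).trans_eq ?_
    rw [Measure.addHaar_closedBall_center]

lemma tendsto_volume_closedBall :
    Tendsto (fun n : ℕ => volume (Metric.closedBall (0 : Plane) (2 * (1 / 2) ^ n))) atTop
      (𝓝 0) := by
  have h1 : Tendsto (fun n : ℕ => (2 : ℝ) * (1 / 2) ^ n) atTop (𝓝 (2 * 0)) :=
    (tendsto_pow_atTop_nhds_zero_of_lt_one (by norm_num) (by norm_num)).const_mul _
  simp_rw [EuclideanSpace.volume_closedBall_fin_two]
  have h2 := ENNReal.Tendsto.mul_const (b := ENNReal.ofReal Real.pi)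
    (((ENNReal.continuous_pow 2).tendsto _).comp
      ((ENNReal.continuous_ofReal.tendsto _).comp h1)) (Or.inr ENNReal.ofReal_ne_top)

  simpa using h2

variable {Ω : Type*} [MeasurableSpace Ω] {P : Measure Ω} [IsProbabilityMeasure P]
  {lam : ℝ≥0} {X : ℕ → Ω → Plane}

namespace IsHPPP

/-- Two coinciding points in a window share a square of every generation. A square `B` holds two
points with probability at most `(λ |B|)²`; summed over the window this is at most `λ² |window|`
times a bound on the area of a square, which tends to zero. -/
lemma ae_injective (hX : IsHPPP P lam X) : ∀ᵐ ω ∂P, Function.Injective (X · ω) := by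
  have key : ∀ w : ℕ, P {ω | ∃ i j, i ≠ j ∧ X i ω = X j ω ∧ X i ω ∈ window w} = 0 := by
    intro w
    set r : ℕ → ℝ≥0∞ := fun n => volume (Metric.closedBall (0 : Plane) (2 * (1 / 2) ^ n))
    have hle : ∀ n, P {ω | ∃ i j, i ≠ j ∧ X i ω = X j ω ∧ X i ω ∈ window w}
        ≤ r n * (lam ^ 2 * volume (window w)) := by
      intro n
      have hBm : ∀ k, MeasurableSet (cell n ⁻¹' {k} ∩ window w) := fun k =>
        (measurableSet_cell n k).inter (measurableSet_window w)
      have hBb : ∀ k, Bornology.IsBounded (cell n ⁻¹' {k} ∩ window w) := fun k =>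
        (isBounded_window w).subset Set.inter_subset_right
      have hsub : {ω | ∃ i j, i ≠ j ∧ X i ω = X j ω ∧ X i ω ∈ window w}
          ⊆ ⋃ k, {ω | 2 ≤ pointCount X (cell n ⁻¹' {k} ∩ window w) ω} := by
        rintro ω ⟨i, j, hij, he, hw⟩
        refine Set.mem_iUnion.2 ⟨cell n (X i ω), ?_⟩
        have : 1 < pointCount X (cell n ⁻¹' {cell n (X i ω)} ∩ window w) ω :=
          Set.one_lt_encard_iff.2 ⟨i, j, ⟨rfl, hw⟩, ⟨by simp [he], he ▸ hw⟩, hij⟩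
        exact Order.add_one_le_of_lt this
      calc _ ≤ ∑' k, P {ω | 2 ≤ pointCount X (cell n ⁻¹' {k} ∩ window w) ω} :=
            (measure_mono hsub).trans (measure_iUnion_le _)
        _ ≤ ∑' k, r n * lam ^ 2 * volume (cell n ⁻¹' {k} ∩ window w) := by
            refine ENNReal.tsum_le_tsum fun k => (hX.measure_two_le (hBm k) (hBb k)).trans ?_
            rw [mul_pow, mul_comm (r n), sq (volume _), mul_assoc]
            gcongr
            exact (measure_mono Set.inter_subset_left).trans (volume_cell_le n k)
        _ = r n * (lam ^ 2 * volume (window w)) := by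
            rw [ENNReal.tsum_mul_left, ← measure_iUnion _ hBm, ← Set.iUnion_inter,
              ← Set.preimage_iUnion, Set.iUnion_of_singleton, Set.preimage_univ, Set.univ_inter,
              mul_assoc]
            intro k l hkl
            refine Disjoint.mono Set.inter_subset_left Set.inter_subset_left ?_
            exact Disjoint.preimage _ (Set.disjoint_singleton.2 hkl)
    have hlim : Tendsto (fun n => r n * (lam ^ 2 * volume (window w))) atTop
        (𝓝 (0 * (lam ^ 2 * volume (window w)))) :=
      ENNReal.Tendsto.mul_const tendsto_volume_closedBall
        (Or.inr (ENNReal.mul_ne_top (by finiteness) (isBounded_window w).measure_lt_top.ne))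
    rw [zero_mul] at hlim
    exact le_antisymm (ge_of_tendsto' hlim hle) zero_le
  have : ∀ᵐ ω ∂P, ∀ w : ℕ, ¬ ∃ i j, i ≠ j ∧ X i ω = X j ω ∧ X i ω ∈ window w :=
    ae_all_iff.2 fun w => by simpa [ae_iff] using key w
  filter_upwards [this] with ω hω i j he
  by_contra hij
  obtain ⟨w, hw⟩ := (eventually_mem_window (X i ω)).exists
  exact hω w ⟨i, j, hij, he, hw⟩

/-- The Mecke formula for functionals in which points in the same dyadic square of side `2⁻ⁿ`
do not interact. -/
lemma lintegral_tsum_expNeg_cell (hX : IsHPPP P lam X) (n : ℕ) {A : Set Plane}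
    (hA : MeasurableSet A) {q : Plane → Plane → ℝ≥0∞} (hq : Measurable (Function.uncurry q))
    (hqn : ∀ x z, cell n x = cell n z → q x z = 0) :
    ∫⁻ ω, ∑' i, A.indicator (fun x => expNeg (∑' j, q x (X j ω))) (X i ω) ∂P =
      lam * ∫⁻ x in A, expNeg (lam * ∫⁻ z, (1 - expNeg (q x z))) := by
  have hXm := hX.measurable
  have hq2 : ∀ {f g : Ω → Plane}, Measurable f → Measurable g → Measurable fun ω => q (f ω) (g ω) :=
    fun hf hg => hq.comp (hf.prodMk hg)
  have h1 : ∀ (k : Fin 2 → ℤ), _ := fun k =>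
    hX.lintegral_tsum_expNeg_compl (measurableSet_cell n k) (isBounded_cell n k)
      (g := A.indicator (1 : Plane → ℝ≥0∞)) (measurable_one.indicator hA) hq
  -- Each point lies in exactly one square, so a sum over squares retains only that one.
  have hpt : ∀ (F : Set Plane → Plane → ℝ≥0∞) (G : Plane → ℝ≥0∞),
      (∀ x, F (cell n ⁻¹' {cell n x}) x = G x) → ∀ x,
      ∑' k, (cell n ⁻¹' {k}).indicator (F (cell n ⁻¹' {k})) x = G x := by
    intro F G h x
    rw [tsum_eq_single (cell n x)]
    · rw [Set.indicator_of_mem (by simp), h]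
    · intro k hk
      have : x ∉ cell n ⁻¹' {k} := fun h => hk (show cell n x = k from h).symm
      rw [Set.indicator_of_notMem this]
  -- Interactions within the square of `x` vanish by `hqn`, so restricting to its complement changes
  -- nothing.
  have hcompl : ∀ x z, (cell n ⁻¹' {cell n x})ᶜ.indicator (q x) z = q x z := by
    intro x z
    by_cases h : cell n z = cell n x
    · rw [Set.indicator_of_notMem (by simpa using h), hqn x z h.symm]
    · rw [Set.indicator_of_mem (by simpa using h)]
  have hL : ∫⁻ ω, ∑' i, A.indicator (fun x => expNeg (∑' j, q x (X j ω))) (X i ω) ∂P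
      = ∑' k, ∫⁻ ω, ∑' i, (cell n ⁻¹' {k}).indicator (fun x => A.indicator 1 x *
        expNeg (∑' j, (cell n ⁻¹' {k})ᶜ.indicator (q x) (X j ω))) (X i ω) ∂P := by
    rw [← lintegral_tsum]
    · refine lintegral_congr fun ω => ?_
      rw [ENNReal.tsum_comm]
      refine tsum_congr fun i => ?_
      symm
      refine hpt (fun Q x => A.indicator 1 x * expNeg (∑' j, Qᶜ.indicator (q x) (X j ω)))
        (A.indicator (fun x => expNeg (∑' j, q x (X j ω)))) (fun x => ?_) (X i ω)
      simp_rw [hcompl]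
      by_cases hx : x ∈ A <;> simp [hx]
    · intro k
      refine (Measurable.tsum fun i => ?_).aemeasurable
      have hk := measurableSet_cell n k
      have e : (fun ω => (cell n ⁻¹' {k}).indicator (fun x => A.indicator 1 x *
        expNeg (∑' j, (cell n ⁻¹' {k})ᶜ.indicator (q x) (X j ω))) (X i ω))
        = fun ω => (X i ⁻¹' (cell n ⁻¹' {k})).indicator (fun ω => A.indicator 1 (X i ω) *
        expNeg (∑' j, (X j ⁻¹' (cell n ⁻¹' {k})ᶜ).indicator
          (fun ω => q (X i ω) (X j ω)) ω)) ω := rfl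
      rw [e]
      refine Measurable.indicator (Measurable.mul ((measurable_one.indicator hA).comp (hXm i))
        (measurable_expNeg.comp (Measurable.tsum fun j => ?_))) (hXm i hk)
      exact (hq2 (hXm i) (hXm j)).indicator (hXm j hk.compl)
  have hR : ∫⁻ x in A, expNeg (lam * ∫⁻ z, (1 - expNeg (q x z)))
      = ∑' k, ∫⁻ x in cell n ⁻¹' {k}, A.indicator 1 x *
        expNeg (lam * ∫⁻ z in (cell n ⁻¹' {k})ᶜ, (1 - expNeg (q x z))) := by
    simp_rw [← lintegral_indicator (measurableSet_cell n _)]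
    rw [← lintegral_tsum, ← lintegral_indicator hA]
    · refine lintegral_congr fun x => ?_
      symm
      refine hpt (fun Q x => A.indicator 1 x * expNeg (lam * ∫⁻ z in Qᶜ, (1 - expNeg (q x z))))
        (A.indicator (fun x => expNeg (lam * ∫⁻ z, (1 - expNeg (q x z))))) (fun x => ?_) x
      have : ∫⁻ z in (cell n ⁻¹' {cell n x})ᶜ, (1 - expNeg (q x z))
          = ∫⁻ z, (1 - expNeg (q x z)) := by
        rw [← lintegral_indicator (measurableSet_cell n _).compl]
        refine lintegral_congr fun z => ?_
        by_cases h : cell n z = cell n x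
        · simp [hqn x z h.symm, h]
        · simp [h]
      rw [this]
      by_cases hx : x ∈ A <;> simp [hx]
    · intro k
      have hm : Measurable fun x : Plane => ∫⁻ z in (cell n ⁻¹' {k})ᶜ, (1 - expNeg (q x z)) :=
        Measurable.lintegral_prod_right' (f := fun p : Plane × Plane => 1 - expNeg (q p.1 p.2))
          (measurable_const.sub (measurable_expNeg.comp hq))
      exact (((measurable_one.indicator hA).mul
        (measurable_expNeg.comp (hm.const_mul _))).indicator (measurableSet_cell n k)).aemeasurable
  rw [hL, hR, ← ENNReal.tsum_mul_left]
  exact tsum_congr h1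

end IsHPPP

end CollabSensing

namespace CollabSensing

open Filter Topology

/-! ### The Mecke formula -/

/-- The part of `q` that concerns pairs of points in different dyadic squares of side `2⁻ⁿ`. -/
noncomputable def offCell (n : ℕ) (q : Plane → Plane → ℝ≥0∞) (x z : Plane) : ℝ≥0∞ :=
  open Classical in if cell n x = cell n z then 0 else q x z

/-- The off-diagonal part of `q`. -/
noncomputable def offDiag (q : Plane → Plane → ℝ≥0∞) (x z : Plane) : ℝ≥0∞ :=
  open Classical in if x = z then 0 else q x z

section OffCell

variable {q : Plane → Plane → ℝ≥0∞}

lemma measurable_offCell (n : ℕ) (hq : Measurable (Function.uncurry q)) :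
    Measurable (Function.uncurry (offCell n q)) := by
  refine Measurable.ite ?_ measurable_const hq
  exact measurableSet_eq_fun ((measurable_cell n).comp measurable_fst)
    ((measurable_cell n).comp measurable_snd)

lemma monotone_offCell (q : Plane → Plane → ℝ≥0∞) (x z : Plane) :
    Monotone fun n => offCell n q x z := by
  intro m n hmn
  simp only [offCell]
  split_ifs with h1 h2
  · exact le_rfl
  · exact zero_le
  · exact absurd (cell_eq_of_le hmn ‹_›) h1
  · exact le_rfl

lemma tendsto_offCell (q : Plane → Plane → ℝ≥0∞) (x z : Plane) :
    Tendsto (fun n => offCell n q x z) atTop (𝓝 (offDiag q x z)) := by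
  by_cases h : x = z
  · simp [offCell, offDiag, h]
  · refine tendsto_const_nhds.congr' ?_
    filter_upwards [eventually_cell_ne h] with n hn
    simp [offCell, offDiag, h, hn]

lemma tendsto_lintegral_offCell (hq : Measurable (Function.uncurry q)) (μ : Measure Plane)
    (x : Plane) :
    Tendsto (fun n => ∫⁻ z, offCell n q x z ∂μ) atTop (𝓝 (∫⁻ z, offDiag q x z ∂μ)) :=
  lintegral_tendsto_of_tendsto_of_monotone
    (fun n => (measurable_offCell n hq).of_uncurry_left.aemeasurable)
    (ae_of_all _ fun z => monotone_offCell q x z) (ae_of_all _ fun z => tendsto_offCell q x z)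

lemma tendsto_lintegral_one_sub_expNeg_offCell (hq : Measurable (Function.uncurry q))
    (x : Plane) :
    Tendsto (fun n => ∫⁻ z, (1 - expNeg (offCell n q x z))) atTop
      (𝓝 (∫⁻ z, (1 - expNeg (q x z)))) := by
  refine lintegral_tendsto_of_tendsto_of_monotone
    (fun n => (measurable_const.sub
      (measurable_expNeg.comp (measurable_offCell n hq).of_uncurry_left)).aemeasurable)
    (ae_of_all _ fun z m n hmn => tsub_le_tsub_left
      (expNeg_antitone (monotone_offCell q x z hmn)) _) ?_
  -- The limit `offDiag q x` differs from `q x` at the single point `x` only, a Lebesgue null set.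
  have hne : ∀ᵐ z : Plane, z ≠ x := by
    simp [ae_iff]
  filter_upwards [hne] with z hz
  have h := tendsto_offCell q x z
  rw [show offDiag q x z = q x z from if_neg hz.symm] at h
  exact ENNReal.Tendsto.sub tendsto_const_nhds ((continuous_expNeg.tendsto _).comp h)
    (Or.inl ENNReal.one_ne_top)

lemma measurable_lintegral_one_sub_expNeg {q : Plane → Plane → ℝ≥0∞}
    (hq : Measurable (Function.uncurry q)) :
    Measurable fun x => ∫⁻ z, (1 - expNeg (q x z)) :=
  Measurable.lintegral_prod_right' (f := fun p : Plane × Plane => 1 - expNeg (q p.1 p.2))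
    (measurable_const.sub (measurable_expNeg.comp hq))

end OffCell

variable {Ω : Type*} [MeasurableSpace Ω] {P : Measure Ω} {lam : ℝ≥0} {X : ℕ → Ω → Plane}

lemma measurable_indicator_expNeg_tsum (hX : ∀ i, Measurable (X i)) {A : Set Plane}
    (hA : MeasurableSet A) {q : ℕ → ℕ → Plane → Plane → ℝ≥0∞}
    (hq : ∀ i j, Measurable (Function.uncurry (q i j))) (i : ℕ) :
    Measurable fun ω => A.indicator (fun x => expNeg (∑' j, q i j x (X j ω))) (X i ω) := by
  change Measurable ((X i ⁻¹' A).indicator fun ω => expNeg (∑' j, q i j (X i ω) (X j ω)))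
  refine Measurable.indicator (measurable_expNeg.comp (Measurable.tsum fun j => ?_)) (hX i hA)
  exact (hq i j).comp ((hX i).prodMk (hX j))

namespace IsHPPP

variable [IsProbabilityMeasure P]

/-- Let the squares shrink in `lintegral_tsum_expNeg_cell`. Boundedness of `A` supplies the
dominating function, the count in `A`, which has finite mean. -/
lemma mecke_of_isBounded (hX : IsHPPP P lam X) {A : Set Plane} (hA : MeasurableSet A)
    (hb : Bornology.IsBounded A) {q : Plane → Plane → ℝ≥0∞}
    (hq : Measurable (Function.uncurry q)) :
    ∫⁻ ω, ∑' i, A.indicator (fun x => expNeg (∑' j, offDiag q x (X j ω))) (X i ω) ∂P =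
      lam * ∫⁻ x in A, expNeg (lam * ∫⁻ z, (1 - expNeg (q x z))) := by
  have h1 : ∀ n, _ := fun n => hX.lintegral_tsum_expNeg_cell n hA (measurable_offCell n hq)
    (fun x z h => if_pos h)
  have hνA : ∫⁻ ω, pointMeasure (X · ω) A ∂P ≠ ∞ := by
    rw [hX.lintegral_pointMeasure_apply hA hb]
    exact ENNReal.mul_ne_top ENNReal.coe_ne_top hb.measure_lt_top.ne
  have hL : Tendsto (fun n => ∫⁻ ω, ∑' i,
      A.indicator (fun x => expNeg (∑' j, offCell n q x (X j ω))) (X i ω) ∂P) atTop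
      (𝓝 (∫⁻ ω, ∑' i, A.indicator (fun x => expNeg (∑' j, offDiag q x (X j ω))) (X i ω) ∂P)) := by
    refine tendsto_lintegral_of_dominated_convergence (fun ω => pointMeasure (X · ω) A)
      (fun n => Measurable.tsum fun i => measurable_indicator_expNeg_tsum hX.measurable hA
        (q := fun _ _ => offCell n q) (fun _ _ => measurable_offCell n hq) i)
      (fun n => ae_of_all _ fun ω => ?_) hνA ?_
    · simp only
      rw [pointMeasure_apply _ hA]
      exact ENNReal.tsum_le_tsum fun i => Set.indicator_le_indicator (expNeg_le_one _)
    · filter_upwards [ae_lt_top (measurable_pointMeasure_apply hX.measurable hA) hνA] with ω hω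
      simp_rw [← lintegral_pointMeasure]
      rw [lintegral_indicator hA]
      simp_rw [lintegral_indicator hA]
      refine tendsto_lintegral_of_dominated_convergence (fun _ => 1) (fun n => ?_)
        (fun n => ae_of_all _ fun x => expNeg_le_one _) (by simpa using hω.ne)
        (ae_of_all _ fun x => (continuous_expNeg.tendsto _).comp
          (tendsto_lintegral_offCell hq _ x))
      simp_rw [lintegral_pointMeasure]
      refine measurable_expNeg.comp (Measurable.tsum fun j => ?_)
      exact (measurable_offCell n hq).of_uncurry_right
  have hR : Tendsto (fun n => lam * ∫⁻ x in A, expNeg (lam * ∫⁻ z, (1 - expNeg (offCell n q x z))))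
      atTop (𝓝 (lam * ∫⁻ x in A, expNeg (lam * ∫⁻ z, (1 - expNeg (q x z))))) := by
    refine ENNReal.Tendsto.const_mul ?_ (Or.inr ENNReal.coe_ne_top)
    refine tendsto_lintegral_of_dominated_convergence (fun _ => 1)
      (fun n => measurable_expNeg.comp
        ((measurable_lintegral_one_sub_expNeg (measurable_offCell n hq)).const_mul _))
      (fun n => ae_of_all _ fun x => expNeg_le_one _) (by simpa using hb.measure_lt_top.ne)
      (ae_of_all _ fun x => (continuous_expNeg.tendsto _).comp
        (ENNReal.Tendsto.const_mul (tendsto_lintegral_one_sub_expNeg_offCell hq x)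
          (Or.inr ENNReal.coe_ne_top)))
  simp_rw [h1] at hL
  exact tendsto_nhds_unique hL hR

/-- The Mecke formula for the exponential functionals of a homogeneous Poisson process. -/
theorem mecke (hX : IsHPPP P lam X) {A : Set Plane} (hA : MeasurableSet A)
    {q : Plane → Plane → ℝ≥0∞} (hq : Measurable (Function.uncurry q)) :
    ∫⁻ ω, ∑' i, A.indicator
        (fun x => expNeg (∑' j, if j = i then 0 else q x (X j ω))) (X i ω) ∂P =
      lam * ∫⁻ x in A, expNeg (lam * ∫⁻ z, (1 - expNeg (q x z))) := by
  have h1 : ∫⁻ ω, ∑' i, A.indicator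
        (fun x => expNeg (∑' j, if j = i then 0 else q x (X j ω))) (X i ω) ∂P
      = ∫⁻ ω, ∑' i, A.indicator (fun x => expNeg (∑' j, offDiag q x (X j ω))) (X i ω) ∂P := by
    refine lintegral_congr_ae ?_
    -- Almost surely, omitting the index `i` is the same as omitting the location `X i ω`.
    filter_upwards [hX.ae_injective] with ω hω
    refine tsum_congr fun i => ?_
    simp only [Set.indicator]
    congr 2
    refine tsum_congr fun j => ?_
    have : X i ω = X j ω ↔ j = i := by rw [hω.eq_iff (a := i) (b := j), eq_comm]
    simp [offDiag, this]
  have hqd : Measurable (Function.uncurry (offDiag q)) :=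
    Measurable.ite (measurableSet_eq_fun measurable_fst measurable_snd) measurable_const hq
  let R : ℕ → Set Plane := disjointed window
  have hRm : ∀ k, MeasurableSet (A ∩ R k) := fun k =>
    hA.inter (MeasurableSet.disjointed measurableSet_window k)
  have hRb : ∀ k, Bornology.IsBounded (A ∩ R k) := fun k =>
    ((isBounded_window k).subset (disjointed_subset _ _)).subset Set.inter_subset_right
  have hRd : Pairwise (Function.onFun Disjoint fun k => A ∩ R k) := fun k l hkl =>
    (disjoint_disjointed window hkl).mono Set.inter_subset_right Set.inter_subset_right
  have hRu : A = ⋃ k, A ∩ R k := by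
    rw [← Set.inter_iUnion, iUnion_disjointed, iUnion_window, Set.inter_univ]
  have hind : ∀ (f : Plane → ℝ≥0∞) x, A.indicator f x = ∑' k, (A ∩ R k).indicator f x := by
    intro f x
    by_cases hx : x ∈ A
    · obtain ⟨k, hk⟩ := Set.mem_iUnion.1 (hRu ▸ hx)
      rw [tsum_eq_single k, Set.indicator_of_mem hx, Set.indicator_of_mem hk]
      intro l hl
      exact Set.indicator_of_notMem (fun h => Set.disjoint_left.1 (hRd hl) h hk) f
    · simp [hx]
  rw [h1]
  simp_rw [hind]
  simp_rw [fun ω => ENNReal.tsum_comm (f := fun i k => (A ∩ R k).indicator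
    (fun x => expNeg (∑' j, offDiag q x (X j ω))) (X i ω))]
  rw [lintegral_tsum fun k => ?_]
  · simp_rw [hX.mecke_of_isBounded (hRm _) (hRb _) hq]
    rw [ENNReal.tsum_mul_left, ← lintegral_iUnion hRm hRd, ← hRu]
  · exact (Measurable.tsum fun i => measurable_indicator_expNeg_tsum hX.measurable (hRm k)
        (q := fun _ _ => offDiag q) (fun _ _ => hqd) i).aemeasurable

end IsHPPP

end CollabSensing

namespace CollabSensing

open Filter Topology

/-! ### Independent marking -/

/-! ### Product laws of the marks -/

section InfiniteProduct

variable {𝕄 : Type*} [MeasurableSpace 𝕄] {F : Measure 𝕄}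

lemma measurable_update_prod (i : ℕ) :
    Measurable fun p : 𝕄 × (ℕ → 𝕄) => Function.update p.2 i p.1 := by
  refine measurable_pi_lambda _ fun j => ?_
  by_cases h : j = i
  · subst h
    simpa using measurable_fst
  · simpa [h, Function.comp_def] using (measurable_pi_apply j).comp
      (measurable_snd (α := 𝕄) (β := ℕ → 𝕄))

variable [IsProbabilityMeasure F]

/-- Resampling one coordinate of an i.i.d. sequence preserves its law. This isolates the mark of
object `i` from the others. -/
lemma map_update_prod_infinitePi (i : ℕ) :
    (F.prod (Measure.infinitePi fun _ : ℕ => F)).map (fun p => Function.update p.2 i p.1) =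
      Measure.infinitePi fun _ : ℕ => F := by
  classical
  refine Measure.eq_infinitePi _ fun s t ht => ?_
  rw [Measure.map_apply (measurable_update_prod i) (MeasurableSet.pi s.countable_toSet fun j _ => ht j)]
  have hpre : (fun p : 𝕄 × (ℕ → 𝕄) => Function.update p.2 i p.1) ⁻¹' (Set.pi s t)
      = (if i ∈ s then t i else Set.univ) ×ˢ (Set.pi (s.erase i : Finset ℕ) t) := by
    ext ⟨m, μ⟩
    simp only [Set.mem_preimage, Set.mem_pi, Set.mem_prod, Finset.mem_coe, Finset.mem_erase]
    constructor
    · intro h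
      refine ⟨?_, fun j hj => by simpa [hj.1] using h j hj.2⟩
      split_ifs with hi
      · simpa using h i hi
      · trivial
    · rintro ⟨h1, h2⟩ j hj
      by_cases hji : j = i
      · subst hji
        simpa [hj] using h1
      · simpa [hji] using h2 j ⟨hji, hj⟩
  rw [hpre, Measure.prod_prod, Measure.infinitePi_pi _ (fun j _ => ht j)]
  split_ifs with hi
  · rw [Finset.mul_prod_erase s (fun j => F (t j)) hi]
  · rw [Finset.erase_eq_of_notMem hi, measure_univ, one_mul]

/-- Writing the product of probabilities as the exponential of a sum brings it into the form
required by the unmarked Mecke formula; a zero factor corresponds to `negLog 0 = ∞`. -/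
lemma infinitePi_forall_ne (i : ℕ) {t : ℕ → Set 𝕄} (ht : ∀ j, MeasurableSet (t j)) :
    Measure.infinitePi (fun _ : ℕ => F) {μ | ∀ j ≠ i, μ j ∈ t j} =
      expNeg (∑' j, if j = i then 0 else negLog (F (t j))) := by
  have h1 : {μ : ℕ → 𝕄 | ∀ j ≠ i, μ j ∈ t j}
      = Set.pi Set.univ fun j => if j = i then Set.univ else t j := by
    ext μ
    simp only [Set.mem_ofPred_eq, Set.mem_pi, Set.mem_univ, true_imp_iff]
    refine forall_congr' fun j => ?_
    split_ifs with h <;> simp [h]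
  rw [h1, Measure.infinitePi_pi_univ, expNeg_tsum]
  · refine tprod_congr fun j => ?_
    split_ifs with h
    · simp
    · exact (expNeg_negLog prob_le_one).symm
  · intro j
    split_ifs with h
    exacts [MeasurableSet.univ, ht j]

lemma infinitePi_forall {t : ℕ → Set 𝕄} (ht : ∀ j, MeasurableSet (t j)) :
    Measure.infinitePi (fun _ : ℕ => F) {μ | ∀ j, μ j ∈ t j} =
      expNeg (∑' j, negLog (F (t j))) := by
  have h1 : {μ : ℕ → 𝕄 | ∀ j, μ j ∈ t j} = Set.pi Set.univ t := by
    ext μ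
    simp
  rw [h1, Measure.infinitePi_pi_univ _ ht, expNeg_tsum]
  exact tprod_congr fun j => (expNeg_negLog prob_le_one).symm

end InfiniteProduct

/-! ### Void events of the marked process -/

namespace IsSensingField

variable {Ω 𝕄 : Type*} [MeasurableSpace Ω] [MeasurableSpace 𝕄] {P : Measure Ω}
  {lam : ℝ≥0} {F : Measure 𝕄} {X : ℕ → Ω → Plane} {M : ℕ → Ω → 𝕄}

lemma isProbabilityMeasure_mark [IsProbabilityMeasure P] (h : IsSensingField P lam F X M) : IsProbabilityMeasure F := by
  rw [← h.mark_law 0]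
  exact Measure.isProbabilityMeasure_map (h.mark_measurable 0).aemeasurable

lemma measurable_points (h : IsSensingField P lam F X M) : Measurable fun ω i => X i ω :=
  measurable_pi_lambda _ h.isHPPP.measurable

lemma measurable_marks (h : IsSensingField P lam F X M) : Measurable fun ω i => M i ω :=
  measurable_pi_lambda _ h.mark_measurable

variable [IsProbabilityMeasure P]

/-- Averaging over the marks first, for given locations. -/
lemma lintegral_eq (h : IsSensingField P lam F X M) {f : (ℕ → Plane) → (ℕ → 𝕄) → ℝ≥0∞}
    (hf : Measurable (Function.uncurry f)) :
    ∫⁻ ω, f (X · ω) (M · ω) ∂P =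
      ∫⁻ ω, ∫⁻ μ, f (X · ω) μ ∂(Measure.infinitePi fun _ : ℕ => F) ∂P := by
  have := h.isProbabilityMeasure_mark
  have h1 := (indepFun_iff_map_prod_eq_prod_map_map h.measurable_points.aemeasurable
    h.measurable_marks.aemeasurable).1 h.mark_indep_points
  have h2 := h.mark_indep.map_fun_eq_infinitePi_map h.mark_measurable
  simp_rw [h.mark_law] at h2
  rw [h2] at h1
  have h3 := lintegral_map (μ := P) hf (h.measurable_points.prodMk h.measurable_marks)
  have := Measure.isProbabilityMeasure_map (μ := P) h.measurable_points.aemeasurable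
  rw [h1, lintegral_prod _ hf.aemeasurable, lintegral_map _ h.measurable_points] at h3
  · exact h3.symm
  · exact hf.lintegral_prod_right'

/-- The Mecke formula for the void probabilities of an independently marked homogeneous Poisson
process. -/
theorem mecke (h : IsSensingField P lam F X M) {G : Set (Plane × 𝕄)}
    {H : Set ((Plane × 𝕄) × (Plane × 𝕄))} (hG : MeasurableSet G) (hH : MeasurableSet H) :
    ∫⁻ ω, ∑' i, {i | (X i ω, M i ω) ∈ G ∧
        ∀ j ≠ i, ((X i ω, M i ω), (X j ω, M j ω)) ∉ H}.indicator 1 i ∂P =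
      lam * ∫⁻ m, ∫⁻ x in {x | (x, m) ∈ G},
        expNeg (lam * ∫⁻ m', volume {z | ((x, m), (z, m')) ∈ H} ∂F) ∂volume ∂F := by
  have := h.isProbabilityMeasure_mark
  let E : ℕ → Set ((ℕ → Plane) × (ℕ → 𝕄)) := fun i =>
    {p | (p.1 i, p.2 i) ∈ G ∧ ∀ j ≠ i, ((p.1 i, p.2 i), (p.1 j, p.2 j)) ∉ H}
  have hpm : ∀ i, Measurable fun p : (ℕ → Plane) × (ℕ → 𝕄) => (p.1 i, p.2 i) := by
    intro i; fun_prop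
  have hE : ∀ i, MeasurableSet (E i) := by
    intro i
    refine (hpm i hG).inter ?_
    have : {p : (ℕ → Plane) × (ℕ → 𝕄) | ∀ j ≠ i, ((p.1 i, p.2 i), (p.1 j, p.2 j)) ∉ H}
        = ⋂ j, ⋂ (_ : j ≠ i), (fun p : (ℕ → Plane) × (ℕ → 𝕄) =>
          ((p.1 i, p.2 i), (p.1 j, p.2 j))) ⁻¹' Hᶜ := by
      ext p; simp
    change MeasurableSet {p : (ℕ → Plane) × (ℕ → 𝕄) |
      ∀ j ≠ i, ((p.1 i, p.2 i), (p.1 j, p.2 j)) ∉ H}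
    rw [this]
    exact MeasurableSet.iInter fun j => MeasurableSet.iInter fun _ =>
      ((hpm i).prodMk (hpm j)) hH.compl
  -- Probability that an object at `z` with a fresh mark does not interact with an object at `x`
  -- with mark `m`.
  let r : 𝕄 → Plane → Plane → ℝ≥0∞ := fun m x z => F {m' | ((x, m), (z, m')) ∉ H}
  have hr : Measurable fun p : 𝕄 × Plane × Plane => r p.1 p.2.1 p.2.2 := by
    have : MeasurableSet {p : (𝕄 × Plane × Plane) × 𝕄 |
        ((p.1.2.1, p.1.1), (p.1.2.2, p.2)) ∉ H} := by
      have hm : Measurable fun p : (𝕄 × Plane × Plane) × 𝕄 =>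
        ((p.1.2.1, p.1.1), (p.1.2.2, p.2)) := by fun_prop
      exact hm hH.compl
    exact measurable_measure_prodMk_left this
  let q : 𝕄 → Plane → Plane → ℝ≥0∞ := fun m x z => negLog (r m x z)
  have hq : Measurable fun p : 𝕄 × Plane × Plane => q p.1 p.2.1 p.2.2 := measurable_negLog.comp hr
  have hqm : ∀ m, Measurable (Function.uncurry (q m)) := fun m =>
    hq.comp (measurable_const.prodMk measurable_id)
  have hsec : ∀ x m z, MeasurableSet {m' | ((x, m), (z, m')) ∉ H} := by
    intro x m z
    have hm : Measurable fun m' : 𝕄 => ((x, m), (z, m')) := by fun_prop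
    exact hm hH.compl
  have h1 : ∀ (ξ : ℕ → Plane) (i : ℕ),
      ∫⁻ μ, (E i).indicator 1 (ξ, μ) ∂(Measure.infinitePi fun _ : ℕ => F)
      = ∫⁻ m, {x | (x, m) ∈ G}.indicator
        (fun x => expNeg (∑' j, if j = i then 0 else q m x (ξ j))) (ξ i) ∂F := by
    intro ξ i
    have hm : Measurable fun μ : ℕ → 𝕄 => (E i).indicator (1 : (ℕ → Plane) × (ℕ → 𝕄) → ℝ≥0∞) (ξ, μ) :=
      (measurable_one.indicator (hE i)).comp measurable_prodMk_left
    -- The mark `m` of object `i` is now integrated separately, the other marks being still i.i.d.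
    conv_lhs => rw [← map_update_prod_infinitePi i]
    rw [lintegral_map hm (measurable_update_prod i),
      lintegral_prod (fun p => (E i).indicator 1 (ξ, Function.update p.2 i p.1))
        (hm.comp (measurable_update_prod i)).aemeasurable]
    refine lintegral_congr fun m => ?_
    by_cases hx : ξ i ∈ {x | (x, m) ∈ G}
    · rw [Set.indicator_of_mem hx, ← infinitePi_forall_ne i (fun j => hsec (ξ i) m (ξ j)),
        ← lintegral_indicator_one]
      · refine lintegral_congr fun μ => ?_
        have : (ξ, Function.update μ i m) ∈ E i ↔
            μ ∈ {μ : ℕ → 𝕄 | ∀ j ≠ i, μ j ∈ {m' | ((ξ i, m), (ξ j, m')) ∉ H}} := by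
          simp only [E, Set.mem_ofPred_eq, Function.update_self, show (ξ i, m) ∈ G from hx, true_and]
          refine forall_congr' fun j => forall_congr' fun hj => ?_
          rw [Function.update_of_ne hj]
        by_cases hμ : (ξ, Function.update μ i m) ∈ E i
        · rw [Set.indicator_of_mem (this.1 hμ), Set.indicator_of_mem hμ]
          rfl
        · rw [Set.indicator_of_notMem (mt this.2 hμ), Set.indicator_of_notMem hμ]
      · have : {μ : ℕ → 𝕄 | ∀ j ≠ i, μ j ∈ {m' | ((ξ i, m), (ξ j, m')) ∉ H}}
            = ⋂ j, ⋂ (_ : j ≠ i), (fun μ : ℕ → 𝕄 => μ j) ⁻¹'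
              {m' | ((ξ i, m), (ξ j, m')) ∉ H} := by
          ext; simp
        rw [this]
        exact MeasurableSet.iInter fun j => MeasurableSet.iInter fun _ =>
          measurable_pi_apply j (hsec _ _ _)
    · rw [Set.indicator_of_notMem hx]
      refine (lintegral_congr fun μ => ?_).trans lintegral_zero
      refine Set.indicator_of_notMem (fun hmem => hx ?_) _
      simpa using hmem.1
  have h2 : ∀ ω, ∑' i, {i | (X i ω, M i ω) ∈ G ∧
        ∀ j ≠ i, ((X i ω, M i ω), (X j ω, M j ω)) ∉ H}.indicator (1 : ℕ → ℝ≥0∞) i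
      = ∑' i, (E i).indicator 1 ((X · ω), (M · ω)) := fun ω => rfl
  have hXm := h.isHPPP.measurable
  simp_rw [h2]
  rw [h.lintegral_eq (f := fun ξ μ => ∑' i, (E i).indicator 1 (ξ, μ))
    (Measurable.tsum fun i => measurable_one.indicator (hE i))]
  simp_rw [fun ω => lintegral_tsum (μ := Measure.infinitePi fun _ : ℕ => F)
    (f := fun i μ => (E i).indicator (1 : (ℕ → Plane) × (ℕ → 𝕄) → ℝ≥0∞) ((X · ω), μ)) (fun i =>
    ((measurable_one.indicator (hE i)).comp measurable_prodMk_left).aemeasurable), h1]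
  have hjoint : ∀ i, Measurable fun p : Ω × 𝕄 => {x | (x, p.2) ∈ G}.indicator
      (fun x => expNeg (∑' j, if j = i then 0 else q p.2 x (X j p.1))) (X i p.1) := by
    intro i
    have hX2 : ∀ j, Measurable fun p : Ω × 𝕄 => X j p.1 := fun j => (hXm j).comp measurable_fst
    change Measurable ((fun p : Ω × 𝕄 => (X i p.1, p.2)) ⁻¹' G |>.indicator fun p =>
      expNeg (∑' j, if j = i then 0 else q p.2 (X i p.1) (X j p.1)))
    refine Measurable.indicator (measurable_expNeg.comp (Measurable.tsum fun j => ?_))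
      (((hX2 i).prodMk measurable_snd) hG)
    split_ifs
    · exact measurable_const
    · exact hq.comp (measurable_snd.prodMk ((hX2 i).prodMk (hX2 j)))
  have h3 : ∫⁻ ω, ∑' i, ∫⁻ m, {x | (x, m) ∈ G}.indicator
        (fun x => expNeg (∑' j, if j = i then 0 else q m x (X j ω))) (X i ω) ∂F ∂P
      = ∫⁻ m, ∫⁻ ω, ∑' i, {x | (x, m) ∈ G}.indicator
        (fun x => expNeg (∑' j, if j = i then 0 else q m x (X j ω))) (X i ω) ∂P ∂F := by
    rw [← lintegral_lintegral_swap (Measurable.tsum hjoint).aemeasurable]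
    refine lintegral_congr fun ω => ?_
    exact (lintegral_tsum fun i => ((hjoint i).comp measurable_prodMk_left).aemeasurable).symm
  rw [h3]
  have hGm : ∀ m, MeasurableSet {x | (x, m) ∈ G} := fun m => measurable_prodMk_right hG
  simp_rw [h.isHPPP.mecke (hGm _) (hqm _)]
  rw [lintegral_const_mul' _ _ ENNReal.coe_ne_top]
  congr 1
  refine lintegral_congr fun m => lintegral_congr fun x => ?_
  congr 2
  have hS : MeasurableSet {p : Plane × 𝕄 | ((x, m), p) ∈ H} := measurable_prodMk_left hH
  -- `1 - exp (-q)` is the probability of interaction; by Fubini its integral over `z` is the mean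
  -- area of the centres that interact.
  have h4 : ∀ z, 1 - expNeg (q m x z) = F (Prod.mk z ⁻¹' {p : Plane × 𝕄 | ((x, m), p) ∈ H}) := by
    intro z
    rw [expNeg_negLog prob_le_one, ← prob_compl_eq_one_sub (hsec x m z)]
    congr 1
    ext m'
    simp
  simp_rw [h4]
  rw [← Measure.prod_apply hS, Measure.prod_apply_symm hS]
  rfl

/-- The void probabilities of an independently marked homogeneous Poisson process. -/
theorem measure_forall_notMem (h : IsSensingField P lam F X M) {D : Set (Plane × 𝕄)}
    (hD : MeasurableSet D) :
    P {ω | ∀ j, (X j ω, M j ω) ∉ D} = expNeg (lam * ∫⁻ m, volume {z | (z, m) ∈ D} ∂F) := by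
  have := h.isProbabilityMeasure_mark
  have hpm : ∀ i, Measurable fun p : (ℕ → Plane) × (ℕ → 𝕄) => (p.1 i, p.2 i) := by
    intro i; fun_prop
  let E : Set ((ℕ → Plane) × (ℕ → 𝕄)) := {p | ∀ j, (p.1 j, p.2 j) ∉ D}
  have hE : MeasurableSet E := by
    have : E = ⋂ j, (fun p : (ℕ → Plane) × (ℕ → 𝕄) => (p.1 j, p.2 j)) ⁻¹' Dᶜ := by
      ext p; simp [E]
    rw [this]
    exact MeasurableSet.iInter fun j => hpm j hD.compl
  have hsec : ∀ z, MeasurableSet {m | (z, m) ∉ D} := fun z => measurable_prodMk_left hD.compl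
  have h1 : P {ω | ∀ j, (X j ω, M j ω) ∉ D}
      = ∫⁻ ω, E.indicator 1 ((X · ω), (M · ω)) ∂P := by
    rw [← lintegral_indicator_one]
    · rfl
    · exact (h.measurable_points.prodMk h.measurable_marks) hE
  rw [h1, h.lintegral_eq (f := fun ξ μ => E.indicator 1 (ξ, μ)) (measurable_one.indicator hE)]
  have h2 : ∀ ξ : ℕ → Plane, ∫⁻ μ, E.indicator 1 (ξ, μ) ∂(Measure.infinitePi fun _ : ℕ => F)
      = expNeg (∫⁻ z, negLog (F {m | (z, m) ∉ D}) ∂pointMeasure ξ) := by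
    intro ξ
    rw [lintegral_pointMeasure, ← infinitePi_forall fun j => hsec (ξ j), ← lintegral_indicator_one]
    · rfl
    · exact measurable_prodMk_left (x := ξ) hE
  simp_rw [h2]
  have hq : Measurable fun z => negLog (F {m | (z, m) ∉ D}) :=
    measurable_negLog.comp (measurable_measure_prodMk_left hD.compl)
  rw [h.isHPPP.lintegral_expNeg hq]
  congr 2
  have h4 : ∀ z, 1 - expNeg (negLog (F {m | (z, m) ∉ D})) = F (Prod.mk z ⁻¹' D) := by
    intro z
    rw [expNeg_negLog prob_le_one, ← prob_compl_eq_one_sub (hsec z)]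
    congr 1
    ext m'
    simp
  simp_rw [h4]
  rw [← Measure.prod_apply hD, Measure.prod_apply_symm hD]
  rfl

end IsSensingField

end CollabSensing

namespace CollabSensing

open Filter Topology

/-! ### Measurability and geometry of the objects -/

lemma mem_singleton_add_iff {a y : Plane} {S : Set Plane} : y ∈ {a} + S ↔ y - a ∈ S := by
  rw [Set.singleton_add]
  constructor
  · rintro ⟨s, hs, rfl⟩
    simpa using hs
  · exact fun h => ⟨y - a, h, by simp⟩

/-- The centres of the translates of `A` that hit `K`. -/
lemma setOf_inter_singleton_add_nonempty (K A : Set Plane) :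
    {z | (K ∩ ({z} + A)).Nonempty} = K + -A := by
  ext z
  simp only [Set.mem_ofPred_eq, Set.mem_add, Set.mem_neg]
  constructor
  · rintro ⟨k, hk, hkz⟩
    exact ⟨k, hk, z - k, by simpa using mem_singleton_add_iff.1 hkz, by simp⟩
  · rintro ⟨k, hk, b, hb, rfl⟩
    exact ⟨k, hk, mem_singleton_add_iff.2 (by simpa using hb)⟩

lemma mem_segment_add_left_iff {x y u c : Plane} :
    c ∈ segment ℝ (x + y) (x + u) ↔ c - x ∈ segment ℝ y u := by
  conv_rhs => rw [← mem_segment_translate ℝ x, add_sub_cancel]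

lemma inter_singleton_add_nonempty_iff {x y u z : Plane} {A : Set Plane} :
    (segment ℝ (x + y) (x + u) ∩ ({z} + A)).Nonempty ↔
      (segment ℝ y u ∩ ({z - x} + A)).Nonempty := by
  constructor
  · rintro ⟨c, hc, hcz⟩
    refine ⟨c - x, mem_segment_add_left_iff.1 hc, mem_singleton_add_iff.2 ?_⟩
    rw [sub_sub_sub_cancel_right]
    exact mem_singleton_add_iff.1 hcz
  · rintro ⟨c, hc, hcz⟩
    refine ⟨c + x, mem_segment_add_left_iff.2 (by simpa using hc), mem_singleton_add_iff.2 ?_⟩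
    rw [mem_singleton_add_iff] at hcz
    convert hcz using 1
    abel

lemma inter_diff_singleton_add_nonempty_iff {x y u z : Plane} {A : Set Plane} :
    ((segment ℝ (x + y) (x + u) \ {x + u}) ∩ ({z} + A)).Nonempty ↔
      ((segment ℝ y u \ {u}) ∩ ({z - x} + A)).Nonempty := by
  constructor
  · rintro ⟨c, ⟨hc, hcu⟩, hcz⟩
    refine ⟨c - x, ⟨mem_segment_add_left_iff.1 hc, fun h => hcu ?_⟩, mem_singleton_add_iff.2 ?_⟩
    · rw [Set.mem_singleton_iff] at h ⊢
      rw [← h, add_sub_cancel]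
    · rw [sub_sub_sub_cancel_right]
      exact mem_singleton_add_iff.1 hcz
  · rintro ⟨c, ⟨hc, hcu⟩, hcz⟩
    refine ⟨c + x, ⟨mem_segment_add_left_iff.2 (by simpa using hc), fun h => hcu ?_⟩,
      mem_singleton_add_iff.2 ?_⟩
    · rw [Set.mem_singleton_iff, add_comm] at h
      exact add_left_cancel h
    · rw [mem_singleton_add_iff] at hcz
      convert hcz using 1
      abel

lemma volume_setOf_inter_segment_nonempty (x y u : Plane) (A : Set Plane) :
    volume {z | (segment ℝ (x + y) (x + u) ∩ ({z} + A)).Nonempty} =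
      volume (segment ℝ y u + -A) := by
  simp_rw [inter_singleton_add_nonempty_iff]
  rw [← setOf_inter_singleton_add_nonempty]
  simp only [sub_eq_add_neg]
  exact measure_preimage_add_right volume (-x) {z | (segment ℝ y u ∩ ({z} + A)).Nonempty}

lemma segment_diff_right_eq {y u : Plane} (h : y ≠ u) :
    segment ℝ y u \ {u} = AffineMap.lineMap y u '' Set.Ico (0 : ℝ) 1 := by
  rw [segment_eq_image_lineMap]
  ext c
  constructor
  · rintro ⟨⟨t, ht, rfl⟩, hc⟩
    refine ⟨t, ⟨ht.1, lt_of_le_of_ne ht.2 ?_⟩, rfl⟩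
    rintro rfl
    simp at hc
  · rintro ⟨t, ht, rfl⟩
    refine ⟨⟨t, ⟨ht.1, ht.2.le⟩, rfl⟩, fun hc => ht.2.ne ?_⟩
    have : AffineMap.lineMap y u t = AffineMap.lineMap y u (1 : ℝ) := by simpa using hc
    exact AffineMap.lineMap_injective ℝ h this

/-- Removing an end point of a segment does not change the area of its dilation by a convex
set. -/
lemma volume_segment_diff_right_add {y u : Plane} (h : y ≠ u) {B : Set Plane} (hB : Convex ℝ B) :
    volume ((segment ℝ y u \ {u}) + B) = volume (segment ℝ y u + B) := by
  set K := segment ℝ y u \ {u} with hK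
  have hKc : Convex ℝ K := by
    rw [hK, segment_diff_right_eq h]
    exact (convex_Ico 0 1).affine_image _
  have hcl : segment ℝ y u ⊆ closure K := by
    rw [hK, segment_diff_right_eq h, segment_eq_image_lineMap, ← closure_Ico zero_ne_one]
    exact image_closure_subset_closure_image (AffineMap.lineMap_continuous)
  have hsub : segment ℝ y u + B ⊆ closure (K + B) := by
    rintro _ ⟨k, hk, b, hb, rfl⟩
    refine closure_mono ?_ (image_closure_subset_closure_image (f := fun k => k + b)
      (by fun_prop) ⟨k, hcl hk, rfl⟩)
    rintro _ ⟨k, hk, rfl⟩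
    exact Set.add_mem_add hk hb
  refine le_antisymm (measure_mono (Set.add_subset_add_right Set.sdiff_subset)) ?_
  -- The larger dilation lies in the closure of `K + B`, which is convex and thus has a null
  -- frontier.
  calc volume (segment ℝ y u + B) ≤ volume (interior (K + B) ∪ frontier (K + B)) := by
        rw [← closure_eq_interior_union_frontier]
        exact measure_mono hsub
    _ ≤ volume (interior (K + B)) + volume (frontier (K + B)) := measure_union_le _ _
    _ ≤ volume (K + B) := by
        rw [(hKc.add hB).addHaar_frontier volume, add_zero]
        exact measure_mono interior_subset

lemma volume_setOf_inter_segment_diff_nonempty (x : Plane) {y u : Plane} (h : y ≠ u)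
    {A : Set Plane} (hA : Convex ℝ A) :
    volume {z | ((segment ℝ (x + y) (x + u) \ {x + u}) ∩ ({z} + A)).Nonempty} =
      volume (segment ℝ y u + -A) := by
  simp_rw [inter_diff_singleton_add_nonempty_iff]
  rw [← volume_segment_diff_right_add h hA.neg, ← setOf_inter_singleton_add_nonempty]
  simp only [sub_eq_add_neg]
  exact measure_preimage_add_right volume (-x)
    {z | ((segment ℝ y u \ {u}) ∩ ({z} + A)).Nonempty}

/-- The angle must be an argument of `z` modulo `2π`, so the uncountable choice of angle becomes a
countable choice of `k`. Measurability of the support rests on this. -/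
lemma mem_polarRegion_iff {ρ : ℝ → ℝ≥0} {z : Plane} :
    z ∈ polarRegion ρ ↔ ∃ k : ℤ,
      ((z 0 : ℂ) + z 1 * Complex.I).arg + k * (2 * Real.pi) ∈ Set.Icc 0 (2 * Real.pi) ∧
      ‖(z 0 : ℂ) + z 1 * Complex.I‖ ≤
        ρ (((z 0 : ℂ) + z 1 * Complex.I).arg + k * (2 * Real.pi)) := by
  set w : ℂ := (z 0 : ℂ) + z 1 * Complex.I with hw
  have hre : w.re = z 0 := by simp [hw]
  have him : w.im = z 1 := by simp [hw]
  constructor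
  · rintro ⟨θ, hθ, r, hr, hz⟩
    have h0 : z 0 = r * Real.cos θ := by rw [hz]; simp
    have h1 : z 1 = r * Real.sin θ := by rw [hz]; simp
    have hwr : w = r * Complex.exp (θ * Complex.I) := by
      rw [hw, h0, h1, Complex.exp_mul_I]
      push_cast
      ring
    have hn : ‖w‖ = r := by
      rw [hwr, norm_mul, Complex.norm_exp_ofReal_mul_I, mul_one, Complex.norm_real,
        Real.norm_of_nonneg hr.1]
    -- At the origin every angle is admissible; `arg 0 = 0` makes `k = 0` a valid choice there.
    rcases hr.1.eq_or_lt with h | h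
    · refine ⟨0, ?_, ?_⟩
      · have : w = 0 := by rw [← norm_eq_zero, hn, h]
        simp [this, Real.pi_pos.le]
      · rw [hn, ← h]
        exact NNReal.coe_nonneg _
    · have he : Complex.exp (θ * Complex.I) = Complex.exp (w.arg * Complex.I) := by
        have h2 := Complex.norm_mul_exp_arg_mul_I w
        rw [hn] at h2
        rw [hwr] at h2 ⊢
        exact (mul_left_cancel₀ (by exact_mod_cast h.ne') h2).symm
      obtain ⟨k, hk⟩ := Complex.exp_eq_exp_iff_exists_int.1 he
      have hk' : θ = w.arg + k * (2 * Real.pi) := by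
        have h3 := congrArg Complex.im hk
        simpa using h3
      exact ⟨k, hk' ▸ hθ, hn ▸ hk' ▸ hr.2⟩
  · rintro ⟨k, hk, hkρ⟩
    refine ⟨_, hk, ‖w‖, ⟨norm_nonneg _, hkρ⟩, ?_⟩
    rw [Real.cos_add_int_mul_two_pi, Real.sin_add_int_mul_two_pi, Complex.norm_mul_cos_arg,
      Complex.norm_mul_sin_arg, hre, him]
    ext i
    fin_cases i <;> rfl

/-- A segment hits a closed set if points of the segment with rational parameter are arbitrarily
close to the set. -/
lemma segment_inter_nonempty_iff {a b : Plane} {A : Set Plane} (hA : IsClosed A) :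
    (segment ℝ a b ∩ A).Nonempty ↔ ∀ n : ℕ, ∃ t : ℚ,
      Metric.infEDist (AffineMap.lineMap a b (max 0 (min 1 (t : ℝ)))) A
        < ((n : ℝ≥0∞) + 1)⁻¹ := by
  -- Clamping to `[0, 1]` lets every rational serve as a parameter of the segment.
  have hcont : Continuous fun t : ℝ =>
      Metric.infEDist (AffineMap.lineMap a b (max 0 (min 1 t)) : Plane) A :=
    Metric.continuous_infEDist.comp (AffineMap.lineMap_continuous.comp (by fun_prop))
  rw [segment_eq_image_lineMap]
  constructor
  · rintro ⟨_, ⟨s, hs, rfl⟩, hsA⟩ n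
    have hopen : IsOpen {t : ℝ | Metric.infEDist
        (AffineMap.lineMap a b (max 0 (min 1 t)) : Plane) A < ((n : ℝ≥0∞) + 1)⁻¹} :=
      isOpen_lt hcont continuous_const
    obtain ⟨t, ht⟩ := Rat.denseRange_cast.exists_mem_open hopen ⟨s, by
      rw [Set.mem_ofPred_eq, min_eq_right hs.2, max_eq_right hs.1,
        Metric.infEDist_zero_of_mem hsA]
      simp⟩
    exact ⟨t, ht⟩
  · intro h
    -- By compactness the distance to `A` attains its minimum on the segment; the minimum is zero,
    -- and `A` is closed.
    obtain ⟨s, hs, hmin⟩ := (isCompact_Icc (a := (0 : ℝ)) (b := 1)).exists_isMinOn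
      ⟨0, by simp⟩ hcont.continuousOn
    have hz : Metric.infEDist (AffineMap.lineMap a b (max 0 (min 1 s)) : Plane) A = 0 := by
      have hle : ∀ n : ℕ, Metric.infEDist (AffineMap.lineMap a b (max 0 (min 1 s)) : Plane) A
          ≤ ((n : ℝ≥0∞) + 1)⁻¹ := by
        intro n
        obtain ⟨t, ht⟩ := h n
        have h1 : max 0 (min 1 (t : ℝ)) ∈ Set.Icc (0 : ℝ) 1 :=
          ⟨le_max_left _ _, max_le zero_le_one (min_le_left _ _)⟩
        have h2 := hmin h1
        simp only [Set.mem_ofPred_eq, min_eq_right h1.2, max_eq_right h1.1] at h2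
        exact h2.trans ht.le
      have hlim : Tendsto (fun n : ℕ => ((n : ℝ≥0∞) + 1)⁻¹) atTop (𝓝 0) := by
        simpa using (tendsto_add_atTop_iff_nat 1).2 ENNReal.tendsto_inv_nat_nhds_zero
      exact le_antisymm (ge_of_tendsto' hlim hle) zero_le
    exact ⟨_, ⟨_, ⟨le_max_left _ _, max_le zero_le_one (min_le_left _ _)⟩, rfl⟩,
      (Metric.mem_iff_infEDist_zero_of_closed hA).2 hz⟩

/-- The half-open segment is a countable union of closed segments stopping at the fraction `1 / (n +
1)` before `u`, which reduces measurability to the closed case. -/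
lemma segment_diff_right_inter_nonempty_iff {y u : Plane} {A : Set Plane} :
    ((segment ℝ y u \ {u}) ∩ A).Nonempty ↔
      y ≠ u ∧ ∃ n : ℕ, (segment ℝ y (AffineMap.lineMap u y (1 / ((n : ℝ) + 1))) ∩ A).Nonempty := by
  by_cases h : y = u
  · subst h
    simp
  rw [segment_diff_right_eq h]
  simp only [ne_eq, h, not_false_eq_true, true_and]
  have key : ∀ s t : ℝ, (AffineMap.lineMap y (AffineMap.lineMap u y s) t : Plane)
      = AffineMap.lineMap y u (t * (1 - s)) := by
    intro s t
    simp only [AffineMap.lineMap_apply, vsub_eq_sub, vadd_eq_add]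
    module
  constructor
  · rintro ⟨_, ⟨t, ht, rfl⟩, hA⟩
    obtain ⟨n, hn⟩ := exists_nat_one_div_lt (sub_pos.2 ht.2)
    refine ⟨n, _, ?_, hA⟩
    have hpos : 0 < 1 - 1 / ((n : ℝ) + 1) := by linarith [ht.1]
    rw [segment_eq_image_lineMap]
    refine ⟨t / (1 - 1 / ((n : ℝ) + 1)), ⟨div_nonneg ht.1 hpos.le, ?_⟩, ?_⟩
    · rw [div_le_one hpos]
      linarith
    · rw [key, div_mul_cancel₀ _ hpos.ne']
  · rintro ⟨n, c, hc, hA⟩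
    rw [segment_eq_image_lineMap] at hc
    obtain ⟨t, ht, rfl⟩ := hc
    refine ⟨_, ⟨t * (1 - 1 / ((n : ℝ) + 1)), ⟨?_, ?_⟩, (key _ _).symm⟩, hA⟩
    · refine mul_nonneg ht.1 (sub_nonneg.2 ?_)
      rw [div_le_one (by positivity)]
      linarith [n.cast_nonneg (α := ℝ)]
    · have h1 : 0 < 1 / ((n : ℝ) + 1) := by positivity
      have h2 : 1 / ((n : ℝ) + 1) ≤ 1 := by
        rw [div_le_one (by positivity)]
        linarith [n.cast_nonneg (α := ℝ)]
      have h3 := mul_le_mul_of_nonneg_right ht.2 (sub_nonneg.2 h2)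
      linarith

/-! ### Joint measurability in location and mark -/

namespace ObjectModel

variable {𝕄 : Type*} [MeasurableSpace 𝕄] (O : ObjectModel 𝕄)

/-- The distance is continuous in the point. In the mark it is measurable because it is below `c`
iff the shape hits a closed ball of some rational radius below `c`, and such balls are compact. -/
lemma measurable_infEDist_shape :
    Measurable fun p : Plane × 𝕄 => Metric.infEDist p.1 (O.shape p.2) := by
  refine measurable_uncurry_of_continuous_of_measurable
    (u := fun (z : Plane) m => Metric.infEDist z (O.shape m))
    (fun m => Metric.continuous_infEDist) fun z => measurable_of_Iio fun c => ?_
  have : (fun m => Metric.infEDist z (O.shape m)) ⁻¹' Set.Iio c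
      = ⋃ q ∈ {q : ℚ | ((Real.toNNReal q : ℝ≥0) : ℝ≥0∞) < c},
        {m | (O.shape m ∩ Metric.closedBall z (Real.toNNReal q)).Nonempty} := by
    ext m
    simp only [Set.mem_preimage, Set.mem_Iio, Metric.infEDist_lt_iff, Set.mem_iUnion,
      Set.mem_ofPred_eq, exists_prop]
    constructor
    · rintro ⟨y, hy, hyc⟩
      obtain ⟨q, _, hq, hqc⟩ := ENNReal.lt_iff_exists_rat_btwn.1 hyc
      refine ⟨q, hqc, y, hy, ?_⟩
      rw [Metric.mem_closedBall, dist_comm, dist_nndist, NNReal.coe_le_coe]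
      rw [edist_nndist, ENNReal.coe_lt_coe] at hq
      exact hq.le
    · rintro ⟨q, hqc, y, hy, hyq⟩
      refine ⟨y, hy, lt_of_le_of_lt ?_ hqc⟩
      rw [Metric.mem_closedBall, dist_comm, dist_nndist, NNReal.coe_le_coe] at hyq
      rw [edist_nndist, ENNReal.coe_le_coe]
      exact hyq
  rw [this]
  exact MeasurableSet.biUnion (Set.to_countable _) fun q _ =>
    O.shape_measurable _ (isCompact_closedBall _ _)

lemma measurableSet_mem_shape : MeasurableSet {p : Plane × 𝕄 | p.1 ∈ O.shape p.2} := by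
  have : {p : Plane × 𝕄 | p.1 ∈ O.shape p.2}
      = (fun p : Plane × 𝕄 => Metric.infEDist p.1 (O.shape p.2)) ⁻¹' {0} := by
    ext p
    simp [Metric.mem_iff_infEDist_zero_of_closed (O.shape_closed p.2)]
  rw [this]
  exact O.measurable_infEDist_shape (measurableSet_singleton 0)

lemma measurableSet_segment_inter_shape :
    MeasurableSet {p : (Plane × Plane) × 𝕄 | (segment ℝ p.1.1 p.1.2 ∩ O.shape p.2).Nonempty} := by
  simp_rw [segment_inter_nonempty_iff (O.shape_closed _)]
  have : ∀ (n : ℕ) (t : ℚ), MeasurableSet {p : (Plane × Plane) × 𝕄 |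
      Metric.infEDist (AffineMap.lineMap p.1.1 p.1.2 (max 0 (min 1 (t : ℝ)))) (O.shape p.2)
        < ((n : ℝ≥0∞) + 1)⁻¹} := by
    intro n t
    have hm : Measurable fun p : (Plane × Plane) × 𝕄 =>
        ((AffineMap.lineMap p.1.1 p.1.2 (max 0 (min 1 (t : ℝ))) : Plane), p.2) := by
      simp only [AffineMap.lineMap_apply, vsub_eq_sub, vadd_eq_add]
      fun_prop
    exact measurableSet_lt (O.measurable_infEDist_shape.comp hm) measurable_const
  simp only [Set.ofPred_forall, Set.ofPred_exists]
  exact MeasurableSet.iInter fun n => MeasurableSet.iUnion fun t => this n t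

lemma measurableSet_segment_diff_inter_shape :
    MeasurableSet {p : (Plane × Plane) × 𝕄 |
      ((segment ℝ p.1.1 p.1.2 \ {p.1.2}) ∩ O.shape p.2).Nonempty} := by
  simp_rw [segment_diff_right_inter_nonempty_iff]
  rw [Set.ofPred_and]
  refine MeasurableSet.inter ?_ ?_
  · exact (measurableSet_eq_fun (measurable_fst.comp measurable_fst)
      (measurable_snd.comp measurable_fst)).compl
  · simp only [Set.ofPred_exists]
    refine MeasurableSet.iUnion fun n => ?_
    have hm : Measurable fun p : (Plane × Plane) × 𝕄 =>
        ((p.1.1, (AffineMap.lineMap p.1.2 p.1.1 (1 / ((n : ℝ) + 1)) : Plane)), p.2) := by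
      simp only [AffineMap.lineMap_apply, vsub_eq_sub, vadd_eq_add]
      fun_prop
    exact hm O.measurableSet_segment_inter_shape

lemma measurableSet_mem_support : MeasurableSet {p : Plane × 𝕄 | p.1 ∈ O.support p.2} := by
  suffices h : MeasurableSet {p : Plane × 𝕄 | p.1 ∈ polarRegion (O.range p.2)} from
    (measurable_snd O.sensors_measurable).inter h
  simp_rw [mem_polarRegion_iff, Set.ofPred_exists]
  refine MeasurableSet.iUnion fun k => ?_
  have hw : Measurable fun p : Plane × 𝕄 => (p.1 0 : ℂ) + p.1 1 * Complex.I := by fun_prop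
  have ha : Measurable fun p : Plane × 𝕄 =>
      ((p.1 0 : ℂ) + p.1 1 * Complex.I).arg + k * (2 * Real.pi) :=
    (Complex.measurable_arg.comp hw).add_const _
  refine MeasurableSet.inter (ha measurableSet_Icc) (measurableSet_le hw.norm ?_)
  exact measurable_coe_nnreal_real.comp (O.range_measurable.comp (measurable_snd.prodMk ha))

end ObjectModel

end CollabSensing

namespace CollabSensing

open Filter Topology

/-! ### Redundancy and covered area -/

lemma segment_inter_singleton_add_nonempty_iff {a b z : Plane} {A : Set Plane} :
    (segment ℝ a b ∩ ({z} + A)).Nonempty ↔ (segment ℝ (a - z) (b - z) ∩ A).Nonempty := by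
  have := inter_singleton_add_nonempty_iff (x := z) (y := a - z) (u := b - z) (z := z) (A := A)
  simpa using this

lemma segment_diff_inter_singleton_add_nonempty_iff {a b z : Plane} {A : Set Plane} :
    ((segment ℝ a b \ {b}) ∩ ({z} + A)).Nonempty ↔
      ((segment ℝ (a - z) (b - z) \ {b - z}) ∩ A).Nonempty := by
  have := inter_diff_singleton_add_nonempty_iff (x := z) (y := a - z) (u := b - z) (z := z)
    (A := A)
  simpa using this

namespace ObjectModel

variable {𝕄 : Type*} [MeasurableSpace 𝕄] (O : ObjectModel 𝕄)

/-- The part of the sensing support outside the shape of the object, relative to its centre. -/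
def outsideSupport (m : 𝕄) : Set Plane := ({O.offset m} + O.support m) \ O.shape m

lemma mem_sensors_of_mem_outsideSupport {m : 𝕄} {u : Plane} (h : u ∈ O.outsideSupport m) :
    m ∈ O.sensors :=
  (mem_singleton_add_iff.1 h.1).1

lemma measurableSet_mem_outsideSupport :
    MeasurableSet {p : Plane × 𝕄 | p.1 ∈ O.outsideSupport p.2} := by
  have h1 : MeasurableSet {p : Plane × 𝕄 | p.1 ∈ {O.offset p.2} + O.support p.2} := by
    simp_rw [mem_singleton_add_iff]
    have := O.offset_measurable
    have hm : Measurable fun p : Plane × 𝕄 => (p.1 - O.offset p.2, p.2) := by fun_prop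
    exact hm O.measurableSet_mem_support
  exact h1.diff O.measurableSet_mem_shape

lemma measurableSet_segment_inter_occupied :
    MeasurableSet {p : (Plane × Plane) × (Plane × 𝕄) |
      (segment ℝ p.1.1 p.1.2 ∩ ({p.2.1} + O.shape p.2.2)).Nonempty} := by
  simp_rw [segment_inter_singleton_add_nonempty_iff]
  have hm : Measurable fun p : (Plane × Plane) × (Plane × 𝕄) =>
    ((p.1.1 - p.2.1, p.1.2 - p.2.1), p.2.2) := by fun_prop
  exact hm O.measurableSet_segment_inter_shape

lemma measurableSet_segment_diff_inter_occupied :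
    MeasurableSet {p : (Plane × Plane) × (Plane × 𝕄) |
      ((segment ℝ p.1.1 p.1.2 \ {p.1.2}) ∩ ({p.2.1} + O.shape p.2.2)).Nonempty} := by
  simp_rw [segment_diff_inter_singleton_add_nonempty_iff]
  have hm : Measurable fun p : (Plane × Plane) × (Plane × 𝕄) =>
    ((p.1.1 - p.2.1, p.1.2 - p.2.1), p.2.2) := by fun_prop
  exact hm O.measurableSet_segment_diff_inter_shape

variable (F : Measure 𝕄)

lemma measurable_meanDilatedArea_segment [SFinite F] :
    Measurable fun p : Plane × Plane => O.meanDilatedArea F (segment ℝ p.1 p.2) := by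
  simp_rw [meanDilatedArea, ← setOf_inter_singleton_add_nonempty]
  have hS : MeasurableSet {p : ((Plane × Plane) × 𝕄) × Plane |
      (segment ℝ p.1.1.1 p.1.1.2 ∩ ({p.2} + O.shape p.1.2)).Nonempty} := by
    have hm : Measurable fun p : ((Plane × Plane) × 𝕄) × Plane => (p.1.1, (p.2, p.1.2)) := by
      fun_prop
    exact hm O.measurableSet_segment_inter_occupied
  exact (measurable_measure_prodMk_left (ν := (volume : Measure Plane)) hS).lintegral_prod_right'

/-- The probability that an object with mark `p.2`, centred at the origin, has an unobstructed
view of `p.1`. -/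
noncomputable def visibility (lam : ℝ≥0) (p : Plane × 𝕄) : ℝ≥0∞ :=
  expNeg (lam * O.meanDilatedArea F (segment ℝ (O.offset p.2) p.1))

lemma measurable_indicator_visibility [SFinite F] (lam : ℝ≥0) :
    Measurable ({p : Plane × 𝕄 | p.1 ∈ O.outsideSupport p.2}.indicator (O.visibility F lam)) := by
  refine Measurable.indicator ?_ O.measurableSet_mem_outsideSupport
  have hm : Measurable fun p : Plane × 𝕄 => (O.offset p.2, p.1) :=
    (O.offset_measurable.comp measurable_snd).prodMk measurable_fst
  exact measurable_expNeg.comp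
    (((O.measurable_meanDilatedArea_segment F).comp hm).const_mul (lam : ℝ≥0∞))

/-- The expected area seen by an object outside its own shape. -/
noncomputable def meanVisibleArea (lam : ℝ≥0) : ℝ≥0∞ :=
  ∫⁻ m, ∫⁻ u in O.outsideSupport m,
    expNeg (lam * O.meanDilatedArea F (segment ℝ (O.offset m) u)) ∂volume ∂F

/-- Objects that are not sensors have empty support, so conditioning on sensors amounts to division
by their probability. -/
lemma visibleAreaIntegral_eq (lam : ℝ≥0) :
    O.visibleAreaIntegral F lam = (F O.sensors)⁻¹ * O.meanVisibleArea F lam := by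
  have h1 : O.visibleAreaIntegral F lam = ∫⁻ m, ∫⁻ u in O.outsideSupport m,
    expNeg (lam * O.meanDilatedArea F (segment ℝ (O.offset m) u)) ∂volume ∂(F[|O.sensors]) := rfl
  rw [h1, ProbabilityTheory.cond, lintegral_smul_measure, smul_eq_mul, meanVisibleArea,
    ← lintegral_indicator O.sensors_measurable]
  congr 1
  refine lintegral_congr fun m => ?_
  by_cases hm : m ∈ O.sensors
  · simp [hm]
  · have : O.outsideSupport m = ∅ :=
      Set.eq_empty_of_forall_notMem fun u hu => hm (O.mem_sensors_of_mem_outsideSupport hu)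
    simp [hm, this]

end ObjectModel

/-! ### Coverage in a single realization -/

section Realization

variable {𝕄 : Type*} [MeasurableSpace 𝕄] {O : ObjectModel 𝕄} {ξ : ℕ → Plane} {μ : ℕ → 𝕄}

/-- Outside the object's own shape only the line-of-sight clause of coverage remains. It tolerates
an obstacle at the target, whence the segment without its end point. -/
lemma mem_coverage_vadd_diff_shape_iff {i : ℕ} {u : Plane} :
    u ∈ ((-ξ i) +ᵥ coverage O ξ μ i) \ O.shape (μ i) ↔
      u ∈ O.outsideSupport (μ i) ∧ ∀ j ≠ i,
        ¬ ((segment ℝ (ξ i + O.offset (μ i)) (ξ i + u) \ {ξ i + u}) ∩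
          ({ξ j} + O.shape (μ j))).Nonempty := by
  have hs : ξ i + u ∈ {ξ i + O.offset (μ i)} + O.support (μ i) ↔
      u ∈ {O.offset (μ i)} + O.support (μ i) := by
    rw [mem_singleton_add_iff, mem_singleton_add_iff, add_sub_add_left_eq_sub]
  have ho : ξ i + u ∈ occupied O ξ μ i ↔ u ∈ O.shape (μ i) := by
    rw [occupied, mem_singleton_add_iff, add_sub_cancel_left]
  have hE : segment ℝ (ξ i + O.offset (μ i)) (ξ i + u) ∩ environmentExcept O ξ μ i ⊆ {ξ i + u} ↔
      ∀ j ≠ i, ¬ ((segment ℝ (ξ i + O.offset (μ i)) (ξ i + u) \ {ξ i + u}) ∩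
          ({ξ j} + O.shape (μ j))).Nonempty := by
    constructor
    · rintro h j hj ⟨c, ⟨hc, hcu⟩, hcj⟩
      exact hcu (h ⟨hc, Set.mem_iUnion₂.2 ⟨j, hj, hcj⟩⟩)
    · rintro h c ⟨hc, hcE⟩
      obtain ⟨j, hj, hcj⟩ := Set.mem_iUnion₂.1 hcE
      by_contra hcu
      exact h j hj ⟨c, ⟨hc, hcu⟩, hcj⟩
  rw [Set.mem_sdiff, Set.mem_vadd_set_iff_neg_vadd_mem, neg_neg, vadd_eq_add]
  simp only [coverage, Set.mem_ofPred_eq, hs, ho, hE, ObjectModel.outsideSupport, Set.mem_sdiff]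
  tauto

/-- At a void location the target is not occupied, so the whole closed segment must be free.
Conversely, a free closed segment and `x` outside the own shape already force `x` to be void. -/
lemma mem_coverage_and_notMem_environment_iff {i : ℕ} {x : Plane} :
    (x ∈ coverage O ξ μ i ∧ x ∉ environment O ξ μ) ↔
      x - ξ i ∈ O.outsideSupport (μ i) ∧ ∀ j ≠ i,
        ¬ (segment ℝ (ξ i + O.offset (μ i)) x ∩ ({ξ j} + O.shape (μ j))).Nonempty := by
  have hs : x ∈ {ξ i + O.offset (μ i)} + O.support (μ i) ↔
      x - ξ i ∈ {O.offset (μ i)} + O.support (μ i) := by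
    rw [mem_singleton_add_iff, mem_singleton_add_iff, sub_sub]
  have ho : x ∈ occupied O ξ μ i ↔ x - ξ i ∈ O.shape (μ i) := by
    rw [occupied, mem_singleton_add_iff]
  constructor
  · rintro ⟨⟨h1, h2⟩, h3⟩
    have h4 : ∀ j, x ∉ occupied O ξ μ j := fun j hj => h3 (Set.mem_iUnion.2 ⟨j, hj⟩)
    refine ⟨⟨hs.1 h1, fun h => h4 i (ho.2 h)⟩, ?_⟩
    rintro j hj ⟨c, hc, hcj⟩
    have := h2.resolve_left (h4 i) ⟨hc, Set.mem_iUnion₂.2 ⟨j, hj, hcj⟩⟩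
    rw [Set.mem_singleton_iff] at this
    exact h4 j (this ▸ hcj)
  · rintro ⟨⟨h1, h2⟩, h3⟩
    refine ⟨⟨hs.2 h1, Or.inr ?_⟩, ?_⟩
    · rintro c ⟨hc, hcE⟩
      obtain ⟨j, hj, hcj⟩ := Set.mem_iUnion₂.1 hcE
      exact absurd ⟨c, hc, hcj⟩ (h3 j hj)
    · intro hx
      obtain ⟨j, hj⟩ := Set.mem_iUnion.1 hx
      by_cases hji : j = i
      · subst hji
        exact h2 (ho.1 hj)
      · exact h3 j hji ⟨x, right_mem_segment ℝ _ _, hj⟩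

lemma notMem_environment_iff {x : Plane} :
    x ∉ environment O ξ μ ↔ ∀ j, x - ξ j ∉ O.shape (μ j) := by
  rw [environment, Set.mem_iUnion, not_exists]
  exact forall_congr' fun j => not_congr mem_singleton_add_iff

lemma mem_sensors_of_mem_coverage {i : ℕ} {x : Plane} (h : x ∈ coverage O ξ μ i) :
    μ i ∈ O.sensors :=
  (mem_singleton_add_iff.1 h.1).1

lemma redundancy_eq_tsum {x : Plane} (hx : x ∉ environment O ξ μ) :
    redundancy O ξ μ (sensorLocations O ξ μ) x =
      ∑' i, {i | x - ξ i ∈ O.outsideSupport (μ i) ∧ ∀ j ≠ i,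
        ¬ (segment ℝ (ξ i + O.offset (μ i)) x ∩
          ({ξ j} + O.shape (μ j))).Nonempty}.indicator (1 : ℕ → ℝ≥0∞) i := by
  simp_rw [← mem_coverage_and_notMem_environment_iff]
  simp only [redundancy, hx, not_false_eq_true, and_true]
  refine tsum_congr fun i => ?_
  congr 1
  ext i
  exact and_iff_right_of_imp fun h => ⟨i, mem_sensors_of_mem_coverage h, rfl⟩

lemma tsum_indicator_eq_zero_of_mem_environment {x : Plane} (hx : x ∈ environment O ξ μ) :
    ∑' i, {i | x - ξ i ∈ O.outsideSupport (μ i) ∧ ∀ j ≠ i,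
        ¬ (segment ℝ (ξ i + O.offset (μ i)) x ∩
          ({ξ j} + O.shape (μ j))).Nonempty}.indicator (1 : ℕ → ℝ≥0∞) i = 0 := by
  simp_rw [← mem_coverage_and_notMem_environment_iff]
  simp [hx]

end Realization

/-- The unit square. -/
def unitSquare : Set Plane := {x | ∀ k, x k ∈ Set.Ico (0 : ℝ) 1}

lemma measurableSet_unitSquare : MeasurableSet unitSquare := by
  simp only [unitSquare, Set.ofPred_forall]
  refine MeasurableSet.iInter fun k => ?_
  have : Measurable fun x : Plane => x k := by fun_prop
  exact this measurableSet_Ico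

lemma volume_unitSquare : volume unitSquare = 1 := by
  have h1 : unitSquare = (WithLp.ofLp : Plane → Fin 2 → ℝ) ⁻¹'
      (Set.pi Set.univ fun _ => Set.Ico (0 : ℝ) 1) := by
    ext x
    simp [unitSquare]
  rw [h1, (PiLp.volume_preserving_ofLp (Fin 2)).measure_preimage
    (MeasurableSet.univ_pi fun _ => measurableSet_Ico).nullMeasurableSet, volume_pi_pi]
  simp

/-! ### Expected redundancy and expected covered area -/

namespace IsSensingField

variable {Ω 𝕄 : Type*} [MeasurableSpace Ω] [MeasurableSpace 𝕄] {P : Measure Ω}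
  {lam : ℝ≥0} {F : Measure 𝕄} {X : ℕ → Ω → Plane} {M : ℕ → Ω → 𝕄}

lemma measurable_point_mark (h : IsSensingField P lam F X M) (i : ℕ) :
    Measurable fun ω => (X i ω, M i ω) :=
  (h.isHPPP.measurable i).prodMk (h.mark_measurable i)

lemma measurableSet_notMem_environment (h : IsSensingField P lam F X M) (O : ObjectModel 𝕄)
    (x : Plane) : MeasurableSet {ω | x ∉ environment O (X · ω) (M · ω)} := by
  have : {ω | x ∉ environment O (X · ω) (M · ω)}
      = ⋂ j, (fun ω => (x - X j ω, M j ω)) ⁻¹' {p : Plane × 𝕄 | p.1 ∈ O.shape p.2}ᶜ := by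
    ext ω
    simp [notMem_environment_iff]
  rw [this]
  refine MeasurableSet.iInter fun j => ?_
  exact ((measurable_const.sub (h.isHPPP.measurable j)).prodMk (h.mark_measurable j))
    O.measurableSet_mem_shape.compl

variable [IsProbabilityMeasure P]

/-- The void probability of the environment. -/
theorem measure_notMem_environment (h : IsSensingField P lam F X M) (O : ObjectModel 𝕄)
    (x : Plane) :
    P {ω | x ∉ environment O (X · ω) (M · ω)} = expNeg (lam * O.meanArea F) := by
  have hD : MeasurableSet {p : Plane × 𝕄 | x - p.1 ∈ O.shape p.2} := by
    have hm : Measurable fun p : Plane × 𝕄 => (x - p.1, p.2) := by fun_prop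
    exact hm O.measurableSet_mem_shape
  have h1 := h.measure_forall_notMem hD
  have h2 : {ω | x ∉ environment O (X · ω) (M · ω)}
      = {ω | ∀ j, (X j ω, M j ω) ∉ {p : Plane × 𝕄 | x - p.1 ∈ O.shape p.2}} := by
    ext ω
    exact notMem_environment_iff
  rw [h2, h1, ObjectModel.meanArea]
  congr 2
  refine lintegral_congr fun m => ?_
  exact (Measure.measurePreserving_sub_left volume x).measure_preimage
    (O.shape_closed m).measurableSet.nullMeasurableSet

/-- The expected redundancy of a location on the event that the location is void. -/
theorem setLIntegral_redundancy (h : IsSensingField P lam F X M) (O : ObjectModel 𝕄)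
    (x : Plane) :
    ∫⁻ ω in {ω | x ∉ environment O (X · ω) (M · ω)},
        redundancy O (X · ω) (M · ω) (sensorLocations O (X · ω) (M · ω)) x ∂P =
      lam * O.meanVisibleArea F lam := by
  classical
  have := h.isProbabilityMeasure_mark
  have hom := O.offset_measurable
  let G : Set (Plane × 𝕄) := {p | x - p.1 ∈ O.outsideSupport p.2}
  let H : Set ((Plane × 𝕄) × (Plane × 𝕄)) := {p |
    (segment ℝ (p.1.1 + O.offset p.1.2) x ∩ ({p.2.1} + O.shape p.2.2)).Nonempty}
  have hG : MeasurableSet G := by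
    have hm : Measurable fun p : Plane × 𝕄 => (x - p.1, p.2) := by fun_prop
    exact hm O.measurableSet_mem_outsideSupport
  have hH : MeasurableSet H := by
    have hm : Measurable fun p : (Plane × 𝕄) × (Plane × 𝕄) =>
      ((p.1.1 + O.offset p.1.2, x), p.2) := by fun_prop
    exact hm O.measurableSet_segment_inter_occupied
  rw [← lintegral_indicator (h.measurableSet_notMem_environment O x)]
  have hred : ∀ ω, {ω | x ∉ environment O (X · ω) (M · ω)}.indicator (fun ω =>
      redundancy O (X · ω) (M · ω) (sensorLocations O (X · ω) (M · ω)) x) ω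
      = ∑' i, {i | (X i ω, M i ω) ∈ G ∧
        ∀ j ≠ i, ((X i ω, M i ω), (X j ω, M j ω)) ∉ H}.indicator 1 i := by
    intro ω
    by_cases hx : ω ∈ {ω | x ∉ environment O (X · ω) (M · ω)}
    · rw [Set.indicator_of_mem hx]
      exact redundancy_eq_tsum hx
    · rw [Set.indicator_of_notMem hx]
      exact (tsum_indicator_eq_zero_of_mem_environment (not_not.1 hx)).symm
  rw [lintegral_congr hred, h.mecke hG hH, ObjectModel.meanVisibleArea]
  congr 1
  refine lintegral_congr fun m => ?_
  have hGm : MeasurableSet {z | (z, m) ∈ G} := measurable_prodMk_right hG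
  have hTm : MeasurableSet (O.outsideSupport m) :=
    measurable_prodMk_right O.measurableSet_mem_outsideSupport
  -- The reflection `u = x - z` turns the integral over centres `z` into one over positions `u`
  -- relative to the centre.
  rw [← lintegral_indicator hGm, ← lintegral_indicator hTm,
    ← lintegral_sub_left_eq_self (fun u => (O.outsideSupport m).indicator _ u) x]
  refine lintegral_congr fun z => ?_
  have h1 : lam * ∫⁻ m', volume {z' | ((z, m), (z', m')) ∈ H} ∂F
      = lam * O.meanDilatedArea F (segment ℝ (O.offset m) (x - z)) := by
    congr 1
    refine lintegral_congr fun m' => ?_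
    rw [← volume_setOf_inter_segment_nonempty z, add_sub_cancel]
    rfl
  by_cases hz : x - z ∈ O.outsideSupport m
  · rw [Set.indicator_of_mem hz, Set.indicator_of_mem (show z ∈ {z | (z, m) ∈ G} from hz), h1]
  · rw [Set.indicator_of_notMem hz,
      Set.indicator_of_notMem (show z ∉ {z | (z, m) ∈ G} from hz)]

/-- Campbell's formula for the covered area of the sensors in the unit square. -/
theorem lintegral_tsum_coveredAreaOutside (h : IsSensingField P lam F X M)
    (O : ObjectModel 𝕄) :
    ∫⁻ ω, ∑' i : ℕ, {i : ℕ | M i ω ∈ O.sensors ∧ ∀ k, X i ω k ∈ Set.Ico (0 : ℝ) 1}.indicator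
        (fun i => coveredAreaOutside O (X · ω) (M · ω) i) i ∂P =
      lam * O.meanVisibleArea F lam := by
  classical
  have := h.isProbabilityMeasure_mark
  have hom := O.offset_measurable
  let G : Plane → Set (Plane × 𝕄) := fun u =>
    {p | p.1 ∈ unitSquare ∧ u ∈ O.outsideSupport p.2}
  let H : Plane → Set ((Plane × 𝕄) × (Plane × 𝕄)) := fun u => {p |
    ((segment ℝ (p.1.1 + O.offset p.1.2) (p.1.1 + u) \ {p.1.1 + u}) ∩
      ({p.2.1} + O.shape p.2.2)).Nonempty}
  have hG : MeasurableSet {p : Plane × (Plane × 𝕄) | p.2 ∈ G p.1} := by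
    have hm : Measurable fun p : Plane × (Plane × 𝕄) => (p.1, p.2.2) := by fun_prop
    exact ((measurable_fst.comp measurable_snd) measurableSet_unitSquare).inter
      (hm O.measurableSet_mem_outsideSupport)
  have hH : MeasurableSet {p : Plane × ((Plane × 𝕄) × (Plane × 𝕄)) | p.2 ∈ H p.1} := by
    have hm : Measurable fun p : Plane × ((Plane × 𝕄) × (Plane × 𝕄)) =>
      ((p.2.1.1 + O.offset p.2.1.2, p.2.1.1 + p.1), p.2.2) := by fun_prop
    exact hm O.measurableSet_segment_diff_inter_occupied
  have hGu : ∀ u, MeasurableSet (G u) := fun u => measurable_prodMk_left hG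
  have hHu : ∀ u, MeasurableSet (H u) := fun u => measurable_prodMk_left hH
  -- The covered area is the integral over `u` of this indicator; after exchanging integrals, the
  -- Mecke formula applies for each fixed `u`.
  let V : Ω → Plane → ℕ → ℝ≥0∞ := fun ω u i => {i | (X i ω, M i ω) ∈ G u ∧
        ∀ j ≠ i, ((X i ω, M i ω), (X j ω, M j ω)) ∉ H u}.indicator 1 i
  have hV : ∀ i, Measurable fun p : Ω × Plane => V p.1 p.2 i := by
    intro i
    have hpm : ∀ j, Measurable fun p : Ω × Plane => (X j p.1, M j p.1) := fun j =>
      (h.measurable_point_mark j).comp measurable_fst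
    have hS : MeasurableSet {p : Ω × Plane | (X i p.1, M i p.1) ∈ G p.2 ∧
        ∀ j ≠ i, ((X i p.1, M i p.1), (X j p.1, M j p.1)) ∉ H p.2} := by
      rw [Set.ofPred_and]
      refine MeasurableSet.inter ((measurable_snd.prodMk (hpm i)) hG) ?_
      simp only [Set.ofPred_forall]
      refine MeasurableSet.iInter fun j => MeasurableSet.iInter fun _ => ?_
      exact (measurable_snd.prodMk ((hpm i).prodMk (hpm j))) hH.compl
    exact measurable_one.indicator hS
  have h1 : ∀ ω i, {i : ℕ | M i ω ∈ O.sensors ∧ ∀ k, X i ω k ∈ Set.Ico (0 : ℝ) 1}.indicator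
        (fun i => coveredAreaOutside O (X · ω) (M · ω) i) i = ∫⁻ u, V ω u i := by
    intro ω i
    have hmem : ∀ u, i ∈ {i | (X i ω, M i ω) ∈ G u ∧
        ∀ j ≠ i, ((X i ω, M i ω), (X j ω, M j ω)) ∉ H u} ↔ X i ω ∈ unitSquare ∧
        u ∈ ((-X i ω) +ᵥ coverage O (X · ω) (M · ω) i) \ O.shape (M i ω) := by
      intro u
      exact Iff.trans and_assoc (and_congr_right fun _ =>
        (mem_coverage_vadd_diff_shape_iff (ξ := (X · ω)) (μ := (M · ω))).symm)
    have hVm : Measurable fun u => V ω u i := (hV i).comp measurable_prodMk_left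
    by_cases hi : i ∈ {i : ℕ | M i ω ∈ O.sensors ∧ ∀ k, X i ω k ∈ Set.Ico (0 : ℝ) 1}
    · rw [Set.indicator_of_mem hi]
      -- Measurability of the shifted coverage set outside the shape is inherited from that of `V`.
      have hS : (fun u => V ω u i) ⁻¹' {1}
          = ((-X i ω) +ᵥ coverage O (X · ω) (M · ω) i) \ O.shape (M i ω) := by
        ext u
        by_cases hu : u ∈ ((-X i ω) +ᵥ coverage O (X · ω) (M · ω) i) \ O.shape (M i ω)
        · simp only [Set.mem_preimage, V, Set.indicator_of_mem ((hmem u).2 ⟨hi.2, hu⟩), hu]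
          simp
        · simp only [Set.mem_preimage, V,
            Set.indicator_of_notMem (fun h' => hu ((hmem u).1 h').2), hu]
          simp
      have hSm := hVm (measurableSet_singleton 1)
      rw [hS] at hSm
      rw [coveredAreaOutside, ← lintegral_indicator_one hSm]
      refine lintegral_congr fun u => ?_
      by_cases hu : u ∈ ((-X i ω) +ᵥ coverage O (X · ω) (M · ω) i) \ O.shape (M i ω)
      · simp only [V, Set.indicator_of_mem ((hmem u).2 ⟨hi.2, hu⟩), Set.indicator_of_mem hu]
        rfl
      · simp only [V, Set.indicator_of_notMem (fun h' => hu ((hmem u).1 h').2),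
          Set.indicator_of_notMem hu]
    · rw [Set.indicator_of_notMem hi]
      refine ((lintegral_congr fun u => ?_).trans lintegral_zero).symm
      refine Set.indicator_of_notMem (fun hmem' => hi ?_) _
      exact ⟨O.mem_sensors_of_mem_outsideSupport hmem'.1.2, hmem'.1.1⟩
  simp_rw [h1]
  have h2 : ∀ ω, ∑' i, ∫⁻ u, V ω u i = ∫⁻ u, ∑' i, V ω u i := fun ω =>
    (lintegral_tsum fun i => ((hV i).comp measurable_prodMk_left).aemeasurable).symm
  simp_rw [h2]
  rw [lintegral_lintegral_swap (Measurable.tsum hV).aemeasurable]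
  have h4 : ∀ u, ∫⁻ ω, ∑' i, V ω u i ∂P = lam * ∫⁻ m, ∫⁻ x in {x | (x, m) ∈ G u},
        expNeg (lam * ∫⁻ m', volume {z | ((x, m), (z, m')) ∈ H u} ∂F) ∂volume ∂F := fun u =>
    h.mecke (hGu u) (hHu u)
  rw [lintegral_congr h4, lintegral_const_mul' _ _ ENNReal.coe_ne_top]
  congr 1
  have hΘ := O.measurable_indicator_visibility F lam
  have h3 : ∀ u m, ∫⁻ x in {x | (x, m) ∈ G u},
        expNeg (lam * ∫⁻ m', volume {z | ((x, m), (z, m')) ∈ H u} ∂F)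
      = {p : Plane × 𝕄 | p.1 ∈ O.outsideSupport p.2}.indicator (O.visibility F lam) (u, m) := by
    intro u m
    by_cases hu : u ∈ O.outsideSupport m
    · have hne : O.offset m ≠ u := by
        rintro rfl
        exact hu.2 (O.offset_mem m (O.mem_sensors_of_mem_outsideSupport hu))
      rw [Set.indicator_of_mem (show (u, m) ∈ {p : Plane × 𝕄 | p.1 ∈ O.outsideSupport p.2} from hu)]
      have hGeq : {x | (x, m) ∈ G u} = unitSquare := by
        ext x
        simp [G, hu]
      have hin : ∀ x, ∫⁻ m', volume {z | ((x, m), (z, m')) ∈ H u} ∂F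
          = O.meanDilatedArea F (segment ℝ (O.offset m) u) := fun x =>
        lintegral_congr fun m' => volume_setOf_inter_segment_diff_nonempty x hne (O.shape_convex m')
      simp_rw [hin]
      -- By translation invariance the integrand does not depend on the centre `x`, and the unit
      -- square has area one.
      rw [hGeq, setLIntegral_const, volume_unitSquare, mul_one]
      rfl
    · have hGeq : {x | (x, m) ∈ G u} = ∅ := by
        ext x
        simp [G, hu]
      rw [hGeq, Set.indicator_of_notMem
        (show (u, m) ∉ {p : Plane × 𝕄 | p.1 ∈ O.outsideSupport p.2} from hu)]
      simp
  simp_rw [h3]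
  rw [lintegral_lintegral_swap (f := fun u m =>
    {p : Plane × 𝕄 | p.1 ∈ O.outsideSupport p.2}.indicator (O.visibility F lam) (u, m))
    hΘ.aemeasurable]
  refine lintegral_congr fun m => ?_
  have hTm : MeasurableSet (O.outsideSupport m) :=
    measurable_prodMk_right O.measurableSet_mem_outsideSupport
  rw [← lintegral_indicator hTm]
  rfl

end IsSensingField

end CollabSensing

/-! ### The theorem -/

open CollabSensing in
theorem theorem2 {Ω 𝕄 : Type*} [MeasurableSpace Ω] [MeasurableSpace 𝕄]
    (P : Measure Ω) [IsProbabilityMeasure P]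
    (lam ps : ℝ≥0) (hlam : 0 < lam) (hps : 0 < ps)
    (F : Measure 𝕄) (O : CollabSensing.ObjectModel 𝕄)
    (X : ℕ → Ω → CollabSensing.Plane) (M : ℕ → Ω → 𝕄)
    (hfield : CollabSensing.IsSensingField P lam F X M)
    (hsensor : F O.sensors = ps)
    (hA : O.meanArea F < ∞)
    (x : CollabSensing.Plane) :
    -- the void event has positive probability, so that one can condition on it
    0 < P {ω | x ∉ CollabSensing.environment O (X · ω) (M · ω)} ∧
    -- `E[R(Φ, Φˢ, x) | x ∉ E] = pₛ λ E|C⁰ \ A⁰| / exp(-λ E|A|)`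
    (∫⁻ ω, CollabSensing.redundancy O (X · ω) (M · ω)
          (CollabSensing.sensorLocations O (X · ω) (M · ω)) x
        ∂(P[|{ω | x ∉ CollabSensing.environment O (X · ω) (M · ω)}])) =
      ps * lam *
          CollabSensing.typicalSensorExpectation P O (ps * lam) X M
            (fun i ω => CollabSensing.coveredAreaOutside O (X · ω) (M · ω) i) /
        EReal.exp (-((lam * O.meanArea F : ℝ≥0∞) : EReal)) ∧
    -- `E|C⁰ \ A⁰|` is given by the integral formula
    CollabSensing.typicalSensorExpectation P O (ps * lam) X M
        (fun i ω => CollabSensing.coveredAreaOutside O (X · ω) (M · ω) i) =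
      O.visibleAreaIntegral F lam := by
  have hps0 : (ps : ℝ≥0∞) ≠ 0 := by exact_mod_cast hps.ne'
  have hlam0 : (lam : ℝ≥0∞) ≠ 0 := by exact_mod_cast hlam.ne'
  have hvoid := hfield.measure_notMem_environment O x
  have htyp : typicalSensorExpectation P O (ps * lam) X M
      (fun i ω => coveredAreaOutside O (X · ω) (M · ω) i)
      = lam * O.meanVisibleArea F lam / ((ps * lam : ℝ≥0) : ℝ≥0∞) := by
    rw [typicalSensorExpectation, hfield.lintegral_tsum_coveredAreaOutside O]
  refine ⟨?_, ?_, ?_⟩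
  · rw [hvoid]
    exact expNeg_pos (ENNReal.mul_ne_top ENNReal.coe_ne_top hA.ne)
  -- The Palm normalisation by `ps * lam`, which is neither zero nor infinite, cancels against the
  -- prefactor and leaves `λ I` on both sides.
  · rw [ProbabilityTheory.cond, lintegral_smul_measure, hfield.setLIntegral_redundancy O x, hvoid,
      htyp, ENNReal.coe_mul, ENNReal.mul_div_cancel (mul_ne_zero hps0 hlam0)
        (ENNReal.mul_ne_top ENNReal.coe_ne_top ENNReal.coe_ne_top), smul_eq_mul, mul_comm,
      ENNReal.div_eq_inv_mul, mul_comm]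
    rfl
  -- Only `λ` cancels; the remaining `1 / ps` is the normalisation of the law conditioned on
  -- sensors.
  · rw [htyp, O.visibleAreaIntegral_eq, hsensor, ENNReal.coe_mul, mul_comm (ps : ℝ≥0∞),
      ENNReal.mul_div_mul_left _ _ hlam0 ENNReal.coe_ne_top, ENNReal.div_eq_inv_mul]
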